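/- **Setting.** For an open set $\Omega\subseteq\mathbb{R}^d$, let $\mathcal{E}_M(\Omega)$ be the set of nets $(u_\varepsilon)_{\varepsilon\in(0,1]}$ in $\mathcal{C}^\infty(\Omega)$ (complex-valued) such that for every compact $K\subset\Omega$ and $l\in\mathbb{N}$ there is $N\in\mathbb{N}$ with $\sup_{x\in K,|\alpha|\le l}|\partial^\alpha u_\varepsilon(x)|=O(\varepsilon^{-N})$ as $\varepsilon\to0$; let $\mathcal{I}(\Omega)$ be the set of those for which this supremum is $O(\varepsilon^{N})$ for every $K$, $l$ and $N$; and let $\mathcal{G}(\Omega)=\mathcal{E}_M(\Omega)/\mathcal{I}(\Omega)$. The support of $u\in\mathcal{G}(\Omega)$ is the complement in $\Omega$ of the largest open subset on which $u$ restricts to $0$, and $\mathcal{G}_C(\Omega)$ is the set of compactly supported elements. The map $\sigma$ sends a smooth function $f$ to the class of the constant net $f_\varepsilon=f$; it maps $\mathcal{D}(\Omega)$ into $\mathcal{G}_C(\Omega)$. A *mollifier* on $\mathbb{R}^d$ is a $\rho\in\mathcal{S}(\mathbb{R}^d)$ with $\int\rho=1$ and $\int x^\alpha\rho(x)\,dx=0$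 for all $\alpha\in\mathbb{N}^d\setminus\{0\}$. Choose $\chi\in\mathcal{D}(\mathbb{R}^d)$ with $0\le\chi\le1$ and $\chi=1$ near $0$, and $\gamma_\varepsilon\in\mathcal{D}(\Omega)$ ($\varepsilon\in(0,1]$) with $0\le\gamma_\varepsilon\le1$ such that for each compact $K\subset\Omega$ one has $\gamma_\varepsilon=1$ on $K$ for all sufficiently small $\varepsilon$. Put $\Theta_\varepsilon(x)=\varepsilon^{-d}\rho(x/\varepsilon)\,\chi(|\ln\varepsilon|\,x)$. For $T\in\mathcal{D}'(\Omega)$ let $i_S(T)\in\mathcal{G}(\Omega)$ be the class of the net $x\mapsto\big((\gamma_\varepsilon T)*\Theta_\varepsilon\big)(x)=\langle T,\gamma_\varepsilon\,\Theta_\varepsilon(x-\cdot)\rangle$. Let $X\subseteq\mathbb{R}^m$ and $Y\subseteq\mathbb{R}^n$ be open. For $H\in\mathcal{G}(X\times Y)$ the generalized integral operator $\widehat H:\mathcal{G}_C(Y)\to\mathcal{G}(X)$ sends $f$ to the class of $x\mapsto\int_K H_\varepsilon(x,y)f_\varepsilon(y)\,dy$, where $(H_\varepsilon)$, $(f_\varepsilon)$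 are representatives of $H$, $f$ and $K\subset Y$ is a compact set whose interior contains the support of $f$. For $h\in\mathcal{D}'(X\times Y)$ the classical operator $\widehat h:\mathcal{D}(Y)\to\mathcal{D}'(X)$ is defined by $\langle\widehat h(f),\varphi\rangle=\langle h,\varphi\otimes f\rangle$. **Theorem.** Let $\rho_1$ and $\rho_2$ be mollifiers on $\mathbb{R}^m$ and $\mathbb{R}^n$. Let $i_S$ on $\mathcal{D}'(X)$ be formed with $\rho_1$ and $i_S$ on $\mathcal{D}'(X\times Y)$ with $\rho_1\otimes\rho_2$, with any admissible choices of $\chi$ and $(\gamma_\varepsilon)$ in each case. Then for every $h\in\mathcal{D}'(X\times Y)$: 1. the nets defining $i_S(h)$ and $i_S(\widehat h(f))$, $f\in\mathcal{D}(Y)$, are moderate, i.e. belong to $\mathcal{E}_M(X\times Y)$ and $\mathcal{E}_M(X)$, and $\widehat{i_S(h)}$ is well defined on $\mathcal{G}_C(Y)$: for each $f\in\mathcal{G}_C(Y)$ the nets defining $\widehat{i_S(h)}(f)$ are moderate, and their class does not depend on the representatives or on $K$; 2. the diagram $$\begin{array}{ccc}\mathcal{D}(Y)&\xrightarrow{\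 \widehat h\ }&\mathcal{D}'(X)\\ \downarrow{\scriptstyle\sigma}&&\downarrow{\scriptstyle i_S}\\ \mathcal{G}_C(Y)&\xrightarrow{\ \widehat{i_S(h)}\ }&\mathcal{G}(X)\end{array}$$ commutes, that is, $i_S\circ\widehat h=\widehat{i_S(h)}\circ\sigma$ on $\mathcal{D}(Y)$. -/

import Mathlib

open Set TopologicalSpace MeasureTheory
open scoped Distributions ContDiff SchwartzMap

namespace Colombeau

section Algebra

variable {E : Type*} [NormedAddCommGroup E] [NormedSpace ℝ E]

/-- The index set `(0,1]` of the regularising parameter. -/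
abbrev Eps : Type := Set.Ioc (0 : ℝ) 1

/-- Nets `(u_ε)` of complex functions. Only their values on the open set under consideration
matter: two nets that agree there have the same class. -/
abbrev Net (E : Type*) : Type _ := Eps → E → ℂ

/-- `p_{K,l}(u_ε) = O(ε ^ e)` as `ε → 0`, where `p_{K,l}` is the supremum over `K` of the
derivatives of order at most `l`. -/
def SeminormBigO (K : Set E) (l : ℕ) (u : Net E) (e : ℤ) : Prop :=
  ∃ C : ℝ, ∃ η : ℝ, 0 < η ∧ ∀ ε : Eps, (ε : ℝ) < η → ∀ x ∈ K, ∀ i ≤ l,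
    ‖iteratedFDeriv ℝ i (u ε) x‖ ≤ C * (ε : ℝ) ^ e

/-- Moderate nets of smooth functions on `Ω`. -/
def IsModerate (Ω : Opens E) (u : Net E) : Prop :=
  (∀ ε, ContDiffOn ℝ ∞ (u ε) Ω) ∧
    ∀ K : Set E, IsCompact K → K ⊆ Ω → ∀ l : ℕ, ∃ N : ℕ, SeminormBigO K l u (-(N : ℤ))

/-- Negligible nets of smooth functions on `Ω`. -/
def IsNegligible (Ω : Opens E) (u : Net E) : Prop :=
  (∀ ε, ContDiffOn ℝ ∞ (u ε) Ω) ∧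
    ∀ K : Set E, IsCompact K → K ⊆ Ω → ∀ l : ℕ, ∀ N : ℕ, SeminormBigO K l u (N : ℤ)

theorem SeminormBigO.mono {K : Set E} {l : ℕ} {u : Net E} {e e' : ℤ}
    (h : SeminormBigO K l u e) (he : e' ≤ e) : SeminormBigO K l u e' := by
  obtain ⟨C, η, hη, H⟩ := h
  refine ⟨|C|, η, hη, fun ε hε x hx i hi => (H ε hε x hx i hi).trans ?_⟩
  have h0 : (0 : ℝ) < ε := ε.2.1
  calc C * (ε : ℝ) ^ e ≤ |C| * (ε : ℝ) ^ e :=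
        mul_le_mul_of_nonneg_right (le_abs_self C) (zpow_pos h0 e).le
    _ ≤ |C| * (ε : ℝ) ^ e' :=
        mul_le_mul_of_nonneg_left (zpow_le_zpow_right_of_le_one₀ h0 ε.2.2 he) (abs_nonneg C)

theorem SeminormBigO.add {Ω : Opens E} {K : Set E} (hK : K ⊆ Ω) {l : ℕ} {u v : Net E} {e : ℤ}
    (hu' : ∀ ε, ContDiffOn ℝ ∞ (u ε) Ω) (hv' : ∀ ε, ContDiffOn ℝ ∞ (v ε) Ω)
    (hu : SeminormBigO K l u e) (hv : SeminormBigO K l v e) :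
    SeminormBigO K l (u + v) e := by
  obtain ⟨C, η, hη, H⟩ := hu
  obtain ⟨C', η', hη', H'⟩ := hv
  refine ⟨C + C', min η η', lt_min hη hη', fun ε hε x hx i hi => ?_⟩
  have hn : (Ω : Set E) ∈ nhds x := Ω.isOpen.mem_nhds (hK hx)
  have e1 : ContDiffAt ℝ i (u ε) x := ((hu' ε).contDiffAt hn).of_le (by exact_mod_cast le_top)
  have e2 : ContDiffAt ℝ i (v ε) x := ((hv' ε).contDiffAt hn).of_le (by exact_mod_cast le_top)
  have : iteratedFDeriv ℝ i ((u + v) ε) x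
      = iteratedFDeriv ℝ i (u ε) x + iteratedFDeriv ℝ i (v ε) x :=
    iteratedFDeriv_add_apply e1 e2
  rw [this, add_mul]
  exact (norm_add_le _ _).trans (add_le_add
    (H ε (hε.trans_le (min_le_left _ _)) x hx i hi)
    (H' ε (hε.trans_le (min_le_right _ _)) x hx i hi))

theorem SeminormBigO.smul {Ω : Opens E} {K : Set E} (hK : K ⊆ Ω) {l : ℕ} {u : Net E} {e : ℤ}
    (c : ℂ) (hu' : ∀ ε, ContDiffOn ℝ ∞ (u ε) Ω) (hu : SeminormBigO K l u e) :
    SeminormBigO K l (c • u) e := by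
  obtain ⟨C, η, hη, H⟩ := hu
  refine ⟨‖c‖ * C, η, hη, fun ε hε x hx i hi => ?_⟩
  have hn : (Ω : Set E) ∈ nhds x := Ω.isOpen.mem_nhds (hK hx)
  have e1 : ContDiffAt ℝ i (u ε) x := ((hu' ε).contDiffAt hn).of_le (by exact_mod_cast le_top)
  have : iteratedFDeriv ℝ i (c • u ε) x = c • iteratedFDeriv ℝ i (u ε) x :=
    iteratedFDeriv_const_smul_apply e1
  change ‖iteratedFDeriv ℝ i (c • u ε) x‖ ≤ _
  rw [this, norm_smul, mul_assoc]
  exact mul_le_mul_of_nonneg_left (H ε hε x hx i hi) (norm_nonneg c)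

theorem seminormBigO_zero (K : Set E) (l : ℕ) (e : ℤ) :
    SeminormBigO K l (0 : Net E) e := by
  refine ⟨0, 1, one_pos, fun ε _ x _ i _ => ?_⟩
  have : iteratedFDeriv ℝ i ((0 : Net E) ε) x = 0 := by
    simp
  rw [this]; simp

/-- The space `𝓔_M(Ω)` of moderate nets. -/
def moderate (Ω : Opens E) : Submodule ℂ (Net E) where
  carrier := {u | IsModerate Ω u}
  zero_mem' := ⟨fun _ => contDiffOn_const, fun K _ _ l => ⟨0, seminormBigO_zero K l _⟩⟩
  add_mem' hu hv := by
    refine ⟨fun ε => (hu.1 ε).add (hv.1 ε), fun K hK hKΩ l => ?_⟩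
    obtain ⟨N, hN⟩ := hu.2 K hK hKΩ l
    obtain ⟨M, hM⟩ := hv.2 K hK hKΩ l
    refine ⟨N + M, SeminormBigO.add hKΩ hu.1 hv.1 (hN.mono ?_) (hM.mono ?_)⟩ <;>
      push_cast <;> omega
  smul_mem' c _ hu := by
    refine ⟨fun ε => (hu.1 ε).const_smul c, fun K hK hKΩ l => ?_⟩
    obtain ⟨N, hN⟩ := hu.2 K hK hKΩ l
    exact ⟨N, hN.smul hKΩ c hu.1⟩

/-- The space `𝓘(Ω)` of negligible nets. -/
def negligible (Ω : Opens E) : Submodule ℂ (Net E) where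
  carrier := {u | IsNegligible Ω u}
  zero_mem' := ⟨fun _ => contDiffOn_const, fun K _ _ l _ => seminormBigO_zero K l _⟩
  add_mem' hu hv :=
    ⟨fun ε => (hu.1 ε).add (hv.1 ε), fun K hK hKΩ l N =>
      SeminormBigO.add hKΩ hu.1 hv.1 (hu.2 K hK hKΩ l N) (hv.2 K hK hKΩ l N)⟩
  smul_mem' c _ hu :=
    ⟨fun ε => (hu.1 ε).const_smul c, fun K hK hKΩ l N =>
      (hu.2 K hK hKΩ l N).smul hKΩ c hu.1⟩

/-- The space `𝓖(Ω) = 𝓔_M(Ω) / 𝓘(Ω)` of generalized functions on `Ω`. -/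
abbrev GenFun (Ω : Opens E) : Type _ := moderate Ω ⧸ (negligible Ω).submoduleOf (moderate Ω)

/-- The net `u` is moderate on `Ω` and its class in `𝓖(Ω)` is `g`. -/
def Represents (Ω : Opens E) (u : Net E) (g : GenFun Ω) : Prop :=
  ∃ hu : u ∈ moderate Ω, Submodule.Quotient.mk ⟨u, hu⟩ = g

open scoped Classical in
/-- The class of a net in `𝓖(Ω)`; it is meaningful for moderate nets only. -/
noncomputable def cl (Ω : Opens E) (u : Net E) : GenFun Ω :=
  if hu : u ∈ moderate Ω then Submodule.Quotient.mk ⟨u, hu⟩ else 0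

/-- A chosen representative of a generalized function. -/
noncomputable def rep {Ω : Opens E} (g : GenFun Ω) : Net E := (Quotient.out g : moderate Ω)

theorem moderate_anti {Ω V : Opens E} (h : V ≤ Ω) : moderate Ω ≤ moderate V :=
  fun _ hu => ⟨fun ε => (hu.1 ε).mono h, fun K hK hKV => hu.2 K hK (hKV.trans h)⟩

theorem negligible_anti {Ω V : Opens E} (h : V ≤ Ω) : negligible Ω ≤ negligible V :=
  fun _ hu => ⟨fun ε => (hu.1 ε).mono h, fun K hK hKV => hu.2 K hK (hKV.trans h)⟩

theorem negligible_le_comap {Ω V : Opens E} (h : V ≤ Ω) :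
    (negligible Ω).submoduleOf (moderate Ω) ≤
      ((negligible V).submoduleOf (moderate V)).comap (Submodule.inclusion (moderate_anti h)) :=
  fun u hu => negligible_anti h (show (u : Net E) ∈ negligible Ω from hu)

/-- Restriction `𝓖(Ω) → 𝓖(V)` for `V ⊆ Ω`. -/
def restrict {Ω V : Opens E} (h : V ≤ Ω) : GenFun Ω →ₗ[ℂ] GenFun V :=
  Submodule.mapQ _ _ (Submodule.inclusion (moderate_anti h))
    (negligible_le_comap h)

/-- The support of `u ∈ 𝓖(Ω)`: the complement in `Ω` of the union of the open subsets of `Ω` on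
which `u` is null. -/
def supp {Ω : Opens E} (u : GenFun Ω) : Set E :=
  (Ω : Set E) \ ⋃ (V : Opens E) (h : V ≤ Ω) (_ : restrict h u = 0), (V : Set E)

/-- The space `𝓖_C(Ω)` of compactly supported generalized functions. -/
abbrev GenFunC (Ω : Opens E) : Type _ := {u : GenFun Ω // IsCompact (supp u)}

theorem const_mem_moderate {Ω : Opens E} {f : E → ℂ} (hf : ContDiffOn ℝ ∞ f Ω) :
    (fun _ : Eps => f) ∈ moderate Ω := by
  refine ⟨fun _ => hf, fun K hK hKΩ l => ⟨0, ?_⟩⟩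
  have hb : ∀ i : ℕ, ∃ C : ℝ, 0 ≤ C ∧ ∀ x ∈ K, ‖iteratedFDeriv ℝ i f x‖ ≤ C := fun i => by
    have hc : ContinuousOn (iteratedFDeriv ℝ i f) K := by
      refine ContinuousOn.mono ?_ hKΩ
      have h1 := hf.continuousOn_iteratedFDerivWithin (m := i)
        (by exact_mod_cast le_top) Ω.isOpen.uniqueDiffOn
      exact h1.congr fun x hx => (iteratedFDerivWithin_of_isOpen i Ω.isOpen hx).symm
    obtain ⟨C, hC⟩ := hK.exists_bound_of_continuousOn hc
    exact ⟨|C|, abs_nonneg C, fun x hx => (hC x hx).trans (le_abs_self C)⟩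
  choose C hC0 hC using hb
  refine ⟨∑ j ∈ Finset.range (l + 1), C j, 1, one_pos, fun ε _ x hx i hi => ?_⟩
  simp only [Nat.cast_zero, neg_zero, zpow_zero, mul_one]
  exact (hC i x hx).trans (Finset.single_le_sum (f := C) (fun j _ => hC0 j)
    (Finset.mem_range.2 (Nat.lt_succ_of_le hi)))

/-- The canonical map `σ : 𝓒^∞(Ω) → 𝓖(Ω)`: the class of the constant net. -/
def sigma (Ω : Opens E) (f : E → ℂ) (hf : ContDiffOn ℝ ∞ f Ω) : GenFun Ω :=
  Submodule.Quotient.mk ⟨fun _ => f, const_mem_moderate hf⟩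

theorem isCompact_supp_sigma {Ω : Opens E} (f : 𝓓(Ω, ℂ)) :
    IsCompact (supp (sigma Ω f f.contDiff.contDiffOn)) := by
  set u := sigma Ω f f.contDiff.contDiffOn with hu
  let V : Opens E := ⟨(Ω : Set E) \ tsupport f, Ω.isOpen.sdiff (isClosed_tsupport f)⟩
  have hV : V ≤ Ω := fun x hx => hx.1
  have hnull : restrict hV u = 0 := by
    rw [hu, sigma, restrict, Submodule.mapQ_apply, Submodule.Quotient.mk_eq_zero]
    refine ⟨fun _ => f.contDiff.contDiffOn, fun K _ hKV l N => ⟨0, 1, one_pos,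
      fun ε _ x hx i _ => ?_⟩⟩
    have : iteratedFDeriv ℝ i (f : E → ℂ) x = 0 := by
      by_contra hne
      exact (hKV hx).2 (support_iteratedFDeriv_subset i hne)
    simp [this]
  have heq : supp u
      = tsupport f \ ⋃ (V : Opens E) (h : V ≤ Ω) (_ : restrict h u = 0), (V : Set E) := by
    refine Subset.antisymm (fun x hx => ⟨?_, hx.2⟩) fun x hx => ⟨f.tsupport_subset hx.1, hx.2⟩
    by_contra hne
    exact hx.2 (mem_iUnion.2 ⟨V, mem_iUnion.2 ⟨hV, mem_iUnion.2 ⟨hnull, ⟨hx.1, hne⟩⟩⟩⟩)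
  rw [heq]
  exact f.hasCompactSupport.isCompact.diff
    (isOpen_iUnion fun V => isOpen_iUnion fun _ => isOpen_iUnion fun _ => V.isOpen)

/-- The canonical map `σ : 𝓓(Ω) → 𝓖_C(Ω)`. -/
noncomputable def sigmaC (Ω : Opens E) (f : 𝓓(Ω, ℂ)) : GenFunC Ω :=
  ⟨sigma Ω f f.contDiff.contDiffOn, isCompact_supp_sigma f⟩

end Algebra

section Embedding

variable {E : Type*} [NormedAddCommGroup E] [NormedSpace ℝ E]

/-- Complex distributions on `Ω`: continuous `ℂ`-linear forms on the complex test functions. -/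
abbrev Distrib (Ω : Opens E) : Type _ := 𝓓(Ω, ℂ) →L[ℂ] ℂ

/-- A function `ρ ∈ 𝓢(E)` with integral one, all of whose moments of positive order vanish.
Moments are taken against products of linear forms, that is, against all monomials in any system
of linear coordinates. -/
structure IsMollifier [MeasureSpace E] (ρ : 𝓢(E, ℂ)) : Prop where
  integral_eq_one : ∫ x, ρ x = 1
  moment_eq_zero : ∀ (k : ℕ), 1 ≤ k → ∀ L : Fin k → (E →L[ℝ] ℝ),
    ∫ x, ((∏ j, L j x : ℝ) : ℂ) * ρ x = 0

/-- The auxiliary cut-off functions used to embed the distributions on `Ω`: a plateau function `χ`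
at the origin, and a net `γ` of plateau functions exhausting `Ω`. -/
structure Cutoff (Ω : Opens E) where
  χ : 𝓓((⊤ : Opens E), ℝ)
  χ_mem : ∀ x, χ x ∈ Set.Icc (0 : ℝ) 1
  χ_eq_one : ∀ᶠ x in nhds (0 : E), χ x = 1
  γ : Eps → 𝓓(Ω, ℝ)
  γ_mem : ∀ ε x, γ ε x ∈ Set.Icc (0 : ℝ) 1
  γ_eq_one : ∀ K : Set E, IsCompact K → K ⊆ Ω →
    ∃ η : ℝ, 0 < η ∧ ∀ ε : Eps, (ε : ℝ) < η → ∀ x ∈ K, γ ε x = 1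

/-- `Θ_ε(x) = ε ^ (-d) ρ(x / ε) χ(|ln ε| x)`, where `d` is the dimension. -/
noncomputable def Theta (ρ : 𝓢(E, ℂ)) (χ : E → ℝ) (ε : Eps) (x : E) : ℂ :=
  (((ε : ℝ) ^ (-(Module.finrank ℝ E : ℤ)) : ℝ) : ℂ) * ρ ((ε : ℝ)⁻¹ • x)
    * (χ (|Real.log ε| • x) : ℂ)

theorem contDiff_Theta (ρ : 𝓢(E, ℂ)) {χ : E → ℝ} (hχ : ContDiff ℝ ∞ χ) (ε : Eps) :
    ContDiff ℝ ∞ (Theta ρ χ ε) := by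
  have h1 : ContDiff ℝ ∞ fun x : E => ρ ((ε : ℝ)⁻¹ • x) :=
    (ρ.smooth ⊤).comp (contDiff_const_smul _)
  have h2 : ContDiff ℝ ∞ fun x : E => ((χ (|Real.log ε| • x) : ℝ) : ℂ) :=
    Complex.ofRealCLM.contDiff.comp (hχ.comp (contDiff_const_smul _))
  exact (contDiff_const.mul h1).mul h2

/-- The test function `ξ ↦ γ_ε(ξ) Θ_ε(x - ξ)` on `Ω`. -/
noncomputable def kernelTest {Ω : Opens E} (ρ : 𝓢(E, ℂ)) (c : Cutoff Ω) (ε : Eps) (x : E) :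
    𝓓(Ω, ℂ) where
  toFun ξ := (c.γ ε ξ : ℂ) * Theta ρ c.χ ε (x - ξ)
  contDiff' := (Complex.ofRealCLM.contDiff.comp (c.γ ε).contDiff).mul
    ((contDiff_Theta ρ c.χ.contDiff ε).comp (contDiff_const.sub contDiff_id))
  hasCompactSupport' := by
    have h : HasCompactSupport fun ξ => (c.γ ε ξ : ℂ) :=
      (c.γ ε).hasCompactSupport.comp_left (g := ((↑) : ℝ → ℂ)) Complex.ofReal_zero
    exact h.mul_right
  tsupport_subset' := by
    refine Subset.trans (closure_mono fun ξ hξ => ?_) (c.γ ε).tsupport_subset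
    intro h0
    exact hξ (by simp [h0])

/-- The net `x ↦ ((γ_ε T) * Θ_ε)(x) = ⟨T, γ_ε Θ_ε(x - ·)⟩`. -/
noncomputable def regularize {Ω : Opens E} (ρ : 𝓢(E, ℂ)) (c : Cutoff Ω) (T : Distrib Ω) : Net E :=
  fun ε x => T (kernelTest ρ c ε x)

/-- The map `i_S : 𝓓'(Ω) → 𝓖(Ω)`. -/
noncomputable def iS {Ω : Opens E} (ρ : 𝓢(E, ℂ)) (c : Cutoff Ω) (T : Distrib Ω) : GenFun Ω :=
  cl Ω (regularize ρ c T)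

end Embedding

section Operators

variable {E F : Type*} [NormedAddCommGroup E] [NormedSpace ℝ E]
  [NormedAddCommGroup F] [NormedSpace ℝ F]

/-- The open set `X × Y`. -/
def prodOpens (X : Opens E) (Y : Opens F) : Opens (E × F) :=
  ⟨(X : Set E) ×ˢ (Y : Set F), X.isOpen.prod Y.isOpen⟩

/-- The tensor product `φ ⊗ f` of two test functions. -/
noncomputable def tensor {X : Opens E} {Y : Opens F} (φ : 𝓓(X, ℂ)) (f : 𝓓(Y, ℂ)) : 𝓓(prodOpens X Y, ℂ) where
  toFun p := φ p.1 * f p.2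
  contDiff' := (φ.contDiff.comp contDiff_fst).mul (f.contDiff.comp contDiff_snd)
  hasCompactSupport' := by
    refine HasCompactSupport.intro
      (φ.hasCompactSupport.isCompact.prod f.hasCompactSupport.isCompact) fun p hp => ?_
    by_contra hne
    exact hp ⟨subset_tsupport _ (left_ne_zero_of_mul hne),
      subset_tsupport _ (right_ne_zero_of_mul hne)⟩
  tsupport_subset' := by
    refine Subset.trans (closure_minimal (t := tsupport φ ×ˢ tsupport f) (fun p hp => ?_)
      ((isClosed_tsupport _).prod (isClosed_tsupport _)))
      (Set.prod_mono φ.tsupport_subset f.tsupport_subset)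
    exact ⟨subset_tsupport _ (left_ne_zero_of_mul hp),
      subset_tsupport _ (right_ne_zero_of_mul hp)⟩

theorem norm_iteratedFDeriv_comp_clm_le {G : Type*} [NormedAddCommGroup G] [NormedSpace ℝ G]
    {f : E → ℂ} (hf : ContDiff ℝ ∞ f) (L : G →L[ℝ] E) (hL : ‖L‖ ≤ 1) (i : ℕ) (p : G) :
    ‖iteratedFDeriv ℝ i (fun q => f (L q)) p‖ ≤ ‖iteratedFDeriv ℝ i f (L p)‖ := by
  have h := L.iteratedFDeriv_comp_right hf p (i := i) (by exact_mod_cast le_top)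
  have h' : iteratedFDeriv ℝ i (fun q => f (L q)) p = _ := h
  rw [h']
  refine (ContinuousMultilinearMap.norm_compContinuousLinearMap_le _ _).trans ?_
  simp only [Finset.prod_const, Finset.card_univ, Fintype.card_fin]
  exact mul_le_of_le_one_right (norm_nonneg _) (pow_le_one₀ (norm_nonneg _) hL)

/-- `φ ↦ φ ⊗ f` on test functions supported in a compact set, as a linear map. -/
noncomputable def tensorLM {Y : Opens F} (K : Compacts E) (f : 𝓓(Y, ℂ)) :
    𝓓_{K}(E, ℂ) →ₗ[ℂ]
      𝓓_{K ×ˢ (⟨tsupport f, f.hasCompactSupport⟩ : Compacts F)}(E × F, ℂ) where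
  toFun φ :=
    { toFun := fun p => φ p.1 * f p.2
      contDiff' := (φ.contDiff.comp contDiff_fst).mul (f.contDiff.comp contDiff_snd)
      zero_on_compl' := fun p hp => by
        by_contra hne
        exact hp ⟨φ.support_subset (left_ne_zero_of_mul hne),
          subset_tsupport _ (right_ne_zero_of_mul hne)⟩ }
  map_add' φ ψ := by
    ext p
    exact add_mul (φ p.1) (ψ p.1) (f p.2)
  map_smul' c φ := by
    ext p
    exact mul_assoc c (φ p.1) (f p.2)

theorem tensorLM_bound {Y : Opens F} (K : Compacts E) (f : 𝓓(Y, ℂ)) (k : ℕ) :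
    ∃ C : ℝ, 0 ≤ C ∧ ∀ (φ : 𝓓_{K}(E, ℂ)) (p : E × F),
      ‖iteratedFDeriv ℝ k (tensorLM K f φ : E × F → ℂ) p‖
        ≤ C * ((Finset.range (k + 1)).sup
            fun j => ContDiffMapSupportedIn.seminorm ℂ E ℂ ⊤ K j) φ := by
  have hb : ∀ i : ℕ, ∃ C : ℝ, 0 ≤ C ∧ ∀ y, ‖iteratedFDeriv ℝ i (f : F → ℂ) y‖ ≤ C := by
    intro i
    obtain ⟨C, hC⟩ := Continuous.bounded_above_of_compact_support
      (f.contDiff.continuous_iteratedFDeriv (m := i) (by exact_mod_cast le_top))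
      (f.hasCompactSupport.iteratedFDeriv i)
    exact ⟨|C|, abs_nonneg C, fun y => (hC y).trans (le_abs_self C)⟩
  choose C hC0 hC using hb
  refine ⟨∑ i ∈ Finset.range (k + 1), (k.choose i : ℝ) * C (k - i),
    Finset.sum_nonneg fun i _ => mul_nonneg (Nat.cast_nonneg _) (hC0 _), fun φ p => ?_⟩
  have h1 := norm_iteratedFDeriv_mul_le (𝕜 := ℝ) (N := ∞)
    (f := fun q : E × F => φ q.1) (g := fun q : E × F => f q.2)
    (φ.contDiff.comp contDiff_fst) (f.contDiff.comp contDiff_snd) p (n := k)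
    (by exact_mod_cast le_top)
  refine h1.trans ?_
  rw [Finset.sum_mul]
  refine Finset.sum_le_sum fun i hi => ?_
  have h2 : ‖iteratedFDeriv ℝ i (fun q : E × F => φ q.1) p‖
      ≤ ‖iteratedFDeriv ℝ i (φ : E → ℂ) p.1‖ :=
    norm_iteratedFDeriv_comp_clm_le φ.contDiff (ContinuousLinearMap.fst ℝ E F)
      (ContinuousLinearMap.norm_fst_le ℝ E F) i p
  have h3 : ‖iteratedFDeriv ℝ (k - i) (fun q : E × F => f q.2) p‖
      ≤ ‖iteratedFDeriv ℝ (k - i) (f : F → ℂ) p.2‖ :=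
    norm_iteratedFDeriv_comp_clm_le f.contDiff (ContinuousLinearMap.snd ℝ E F)
      (ContinuousLinearMap.norm_snd_le ℝ E F) (k - i) p
  have h4 := (ContDiffMapSupportedIn.norm_iteratedFDeriv_apply_le_seminorm_top ℂ
    (i := i) (f := φ) (x := p.1)).trans
    (Seminorm.le_finset_sup_apply (p := fun j => ContDiffMapSupportedIn.seminorm ℂ E ℂ ⊤ K j)
      (x := φ) hi)
  refine (mul_le_mul (mul_le_mul_of_nonneg_left (h2.trans h4) (Nat.cast_nonneg _))
    (h3.trans (hC _ _)) (norm_nonneg _)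
    (mul_nonneg (Nat.cast_nonneg _) (apply_nonneg _ _))).trans_eq ?_
  ring

/-- `φ ↦ φ ⊗ f` on test functions supported in a compact set, as a continuous linear map. -/
noncomputable def tensorK {Y : Opens F} (K : Compacts E) (f : 𝓓(Y, ℂ)) :
    𝓓_{K}(E, ℂ) →L[ℂ]
      𝓓_{K ×ˢ (⟨tsupport f, f.hasCompactSupport⟩ : Compacts F)}(E × F, ℂ) where
  toLinearMap := tensorLM K f
  cont := show Continuous (tensorLM K f) by
    refine WithSeminorms.continuous_of_isBounded (ContDiffMapSupportedIn.withSeminorms ..)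
      (ContDiffMapSupportedIn.withSeminorms ..) _ (.of_real fun k => ?_)
    obtain ⟨C, hC, h⟩ := tensorLM_bound K f k
    exact ⟨Finset.range (k + 1), C, fun φ => (ContDiffMapSupportedIn.seminorm_le_iff ℂ
      (mul_nonneg hC (apply_nonneg _ _)) k _).2 fun _ p _ => h φ p⟩

/-- `φ ↦ φ ⊗ f` as a continuous linear map `𝓓(X) → 𝓓(X × Y)`. -/
noncomputable def tensorCLM {X : Opens E} {Y : Opens F} (f : 𝓓(Y, ℂ)) :
    𝓓(X, ℂ) →L[ℂ] 𝓓(prodOpens X Y, ℂ) :=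
  TestFunction.limitCLM ℂ (fun φ => tensor φ f)
    (fun K hK => TestFunction.ofSupportedInCLM ℂ
      (Set.prod_mono hK f.tsupport_subset) ∘L tensorK K f)
    (fun _ _ _ => rfl)

/-- The operator `ĥ : 𝓓(Y) → 𝓓'(X)` with distributional kernel `h ∈ 𝓓'(X × Y)`:
`⟨ĥ(f), φ⟩ = ⟨h, φ ⊗ f⟩`. -/
noncomputable def kernelOp {X : Opens E} {Y : Opens F} (h : Distrib (prodOpens X Y))
    (f : 𝓓(Y, ℂ)) : Distrib X :=
  h ∘L tensorCLM f

theorem kernelOp_apply {X : Opens E} {Y : Opens F} (h : Distrib (prodOpens X Y))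
    (f : 𝓓(Y, ℂ)) (φ : 𝓓(X, ℂ)) : kernelOp h f φ = h (tensor φ f) := rfl

/-- The net `x ↦ ∫_K H_ε(x, y) f_ε(y) dy`. -/
noncomputable def integralNet [MeasureSpace F] (H : Net (E × F)) (f : Net F) (K : Set F) : Net E :=
  fun ε x => ∫ y in K, H ε (x, y) * f ε y

theorem supp_subset {Ω : Opens E} (u : GenFun Ω) : supp u ⊆ Ω := fun _ hx => hx.1

/-- A compact subset of `Y` that is a neighbourhood of the support of `f`. -/
noncomputable def nbhdSupp [LocallyCompactSpace F] {Y : Opens F} (f : GenFunC Y) : Set F :=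
  (exists_compact_between f.2 Y.isOpen (supp_subset f.1)).choose

/-- The generalized integral operator `Ĥ : 𝓖_C(Y) → 𝓖(X)` with kernel `H ∈ 𝓖(X × Y)`: the class
of `x ↦ ∫_K H_ε(x, y) f_ε(y) dy`, where `K ⊆ Y` is a compact neighbourhood of the support of `f`. -/
noncomputable def genIntOp [MeasureSpace F] [LocallyCompactSpace F] {X : Opens E} {Y : Opens F}
    (H : GenFun (prodOpens X Y)) (f : GenFunC Y) : GenFun X :=
  cl X (integralNet (rep H) (rep f.1) (nbhdSupp f))

/-- The definition of `Ĥ(f)` is meaningful: the nets that define it are moderate, and their class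
depends neither on the representatives of `H` and `f` nor on the compact neighbourhood of the
support of `f`. -/
def GenIntOpWellDefined [MeasureSpace F] [LocallyCompactSpace F] {X : Opens E} {Y : Opens F}
    (H : GenFun (prodOpens X Y)) (f : GenFunC Y) : Prop :=
  ∀ (u : Net (E × F)) (v : Net F) (K : Set F),
    Represents (prodOpens X Y) u H → Represents Y v f.1 →
    IsCompact K → supp f.1 ⊆ interior K → K ⊆ Y →
      Represents X (integralNet u v K) (genIntOp H f)

end Operators

end Colombeau

namespace Colombeau

set_option linter.unusedSectionVars false

/-! ### Smooth families of functions as smooth maps into `C(M, W)` -/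

section Slices

variable {E G W : Type} [NormedAddCommGroup E] [NormedSpace ℝ E]
  [NormedAddCommGroup G] [NormedSpace ℝ G] [NormedAddCommGroup W] [NormedSpace ℝ W]

/-! On test functions supported in a fixed compact set `M`, a distribution has finite order, so by
Hahn–Banach it is a continuous linear form `S` on the Banach space `C(M, Jet G k)`, applied to the
jet of the test function (`exists_jet_extension`). If the test function depends smoothly on a
parameter, so does its jet as an element of that space (`contDiff_jetOn`). Smoothness of `⟨T, φ_x⟩`
in `x`, bounds for its derivatives and exchange with integrals (`integral_jetOn`) thus reduce to
facts about one bounded linear form. Since `Θ_ε` has uniformly moderate derivatives, regularisations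
are moderate.

The generalized operator is well defined because bounds pass through an integral over a compact set,
and because a representative of `f` is negligible on every compact set that misses the support of
`f`.

For the diagram, let `x` lie near a compact set and `ε` be small. Then both cut-offs `γ` disappear,
and the difference of the two nets is `h` applied in `(ξ, η)` to `D_ε(x - ξ, η)`, where `D_ε(z, η) =
Θ¹_ε(z) f(η) - ∫ Θ_ε(z, y - η) f(y) dy` is `kernelDiff`. Replacing the cut-offs `χ` by `1` costs a
negligible error: where `χ(|ln ε| x)` differs from `1`, the argument `x / ε` has size at least a
constant over `ε |ln ε|`, and Schwartz decay beats every power of `ε`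
(`unifNegligible_schwartz_mul`). With `χ = 1` the kernel factors, `D_ε` becomes `Θ¹_ε(z)` times the
error of mollifying `f`, and Taylor's formula with the vanishing moments makes this error `O(ε ^ N)`
for every `N`, with all derivatives (`unifNegligible_mollifyError`). A moderate factor times a
negligible one is negligible, and the linear form representing `h` preserves this. -/

theorem iteratedFDeriv_comp_affine {f : G → W} {s : Set G} (hs : IsOpen s)
    (hf : ContDiffOn ℝ ∞ f s) (L : E →L[ℝ] G) (a : G) {x : E} (hx : L x + a ∈ s) (i : ℕ) :
    iteratedFDeriv ℝ i (fun y => f (L y + a)) x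
      = (iteratedFDeriv ℝ i f (L x + a)).compContinuousLinearMap fun _ => L := by
  set t : Set G := (fun y => y + a) ⁻¹' s with ht
  have hto : IsOpen t := hs.preimage (by fun_prop)
  have hft : ContDiffOn ℝ ∞ (fun y => f (y + a)) t :=
    hf.comp (contDiff_id.add contDiff_const).contDiffOn fun y hy => hy
  have h := L.iteratedFDerivWithin_comp_right hft hto.uniqueDiffOn
    (hto.preimage L.continuous).uniqueDiffOn (x := x) hx (i := i) (by exact_mod_cast le_top)
  rw [iteratedFDerivWithin_of_isOpen i (hto.preimage L.continuous) (show x ∈ L ⁻¹' t from hx),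
    iteratedFDerivWithin_of_isOpen i hto (show L x ∈ t from hx),
    iteratedFDeriv_comp_add_right] at h
  exact h

theorem norm_iteratedFDeriv_comp_affine_le {f : G → W} {s : Set G} (hs : IsOpen s)
    (hf : ContDiffOn ℝ ∞ f s) (L : E →L[ℝ] G) (a : G) {x : E} (hx : L x + a ∈ s) (i : ℕ) :
    ‖iteratedFDeriv ℝ i (fun y => f (L y + a)) x‖
      ≤ ‖iteratedFDeriv ℝ i f (L x + a)‖ * ‖L‖ ^ i := by
  rw [iteratedFDeriv_comp_affine hs hf L a hx]
  refine (ContinuousMultilinearMap.norm_compContinuousLinearMap_le _ _).trans ?_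
  simp

/-- The two sides differ only by currying isometries. The order `j` is generalised because each step
of the induction moves one derivative from the inner to the outer one. -/
theorem norm_iteratedFDeriv_iteratedFDeriv (f : G → W) (i j : ℕ) (x : G) :
    ‖iteratedFDeriv ℝ j (iteratedFDeriv ℝ i f) x‖ = ‖iteratedFDeriv ℝ (i + j) f x‖ := by
  induction i generalizing j with
  | zero =>
    have h : iteratedFDeriv ℝ 0 f
        = (continuousMultilinearCurryFin0 ℝ G W).symm ∘ f := iteratedFDeriv_zero_eq_comp
    rw [h, LinearIsometryEquiv.norm_iteratedFDeriv_comp_left, zero_add]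
  | succ i ih =>
    let g : (G →L[ℝ] G [×i]→L[ℝ] W) ≃ₗᵢ[ℝ] G [×(i + 1)]→L[ℝ] W :=
      (continuousMultilinearCurryLeftEquiv ℝ (fun _ : Fin (i + 1) => G) W).symm
    have h : iteratedFDeriv ℝ (i + 1) f = g ∘ fderiv ℝ (iteratedFDeriv ℝ i f) :=
      iteratedFDeriv_succ_eq_comp_left
    have h2 := LinearIsometryEquiv.norm_iteratedFDeriv_comp_left (𝕜 := ℝ) (E := G)
      (F := G →L[ℝ] G [×i]→L[ℝ] W) (G := G [×(i + 1)]→L[ℝ] W) g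
      (fderiv ℝ (iteratedFDeriv ℝ i f)) x j
    rw [h, h2, norm_iteratedFDeriv_fderiv, ih, add_right_comm, add_assoc]

open scoped Classical in
/-- The restriction to a compact set, as a continuous map (zero if `f` is not continuous there). -/
noncomputable def restr (M : Compacts G) (f : G → W) : C(M, W) :=
  if h : Continuous fun z : M => f z then ⟨_, h⟩ else 0

theorem restr_apply {M : Compacts G} {f : G → W} (h : ContinuousOn f M) (z : M) :
    restr M f z = f z := by
  have h' : Continuous fun z : M => f z := continuousOn_iff_continuous_domRestrict.1 h
  rw [restr, dif_pos h']
  rfl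

theorem continuousOn_slice {U : Set E} {V : Set G} {M : Compacts G} (hM : (M : Set G) ⊆ V)
    {Ψ : E × G → W} (hΨ : ContinuousOn Ψ (U ×ˢ V)) {x : E} (hx : x ∈ U) :
    ContinuousOn (fun z => Ψ (x, z)) M :=
  hΨ.comp (by fun_prop) fun _ hz => ⟨hx, hM hz⟩

/-- Currying: for compact `M` the sup-norm topology is the compact-open one, so joint continuity
suffices. -/
theorem continuousOn_restr {U : Set E} {V : Set G} {M : Compacts G} (hM : (M : Set G) ⊆ V)
    {Ψ : E × G → W} (hΨ : ContinuousOn Ψ (U ×ˢ V)) :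
    ContinuousOn (fun x => restr M fun z => Ψ (x, z)) U := by
  rw [continuousOn_iff_continuous_domRestrict]
  have hc : Continuous fun p : U × M => Ψ (p.1, p.2) :=
    hΨ.comp_continuous (by fun_prop) fun p => ⟨p.1.2, hM p.2.2⟩
  have h := (ContinuousMap.curry ⟨_, hc⟩).continuous
  refine h.congr fun x => ?_
  ext z
  rw [Set.domRestrict_apply, restr_apply (continuousOn_slice hM hΨ x.2)]
  rfl

/-- A continuous family of linear maps, as a linear map with values in continuous functions. -/
noncomputable def swapCLM (E W : Type) [NormedAddCommGroup E] [NormedSpace ℝ E]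
    [NormedAddCommGroup W] [NormedSpace ℝ W] (M : Type) [TopologicalSpace M] [CompactSpace M] :
    C(M, E →L[ℝ] W) →L[ℝ] E →L[ℝ] C(M, W) :=
  LinearMap.mkContinuous₂
    (LinearMap.mk₂ ℝ (fun (A : C(M, E →L[ℝ] W)) (v : E) =>
        (⟨fun z => A z v, by fun_prop⟩ : C(M, W)))
      (fun _ _ _ => by ext; simp) (fun _ _ _ => by ext; simp)
      (fun _ _ _ => by ext; simp) (fun _ _ _ => by ext; simp)) 1
    fun A v => by
      rw [one_mul]
      refine (ContinuousMap.norm_le _ (by positivity)).2 fun z => ?_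
      exact ((A z).le_opNorm v).trans
        (mul_le_mul_of_nonneg_right (A.norm_coe_le_norm z) (norm_nonneg _))

theorem swapCLM_apply {M : Type} [TopologicalSpace M] [CompactSpace M]
    (A : C(M, E →L[ℝ] W)) (v : E) (z : M) : swapCLM E W M A v z = A z v := rfl

theorem hasFDerivAt_slice {U : Set E} {V : Set G} (hU : IsOpen U) (hV : IsOpen V)
    {Ψ : E × G → W} (hΨ : ContDiffOn ℝ ∞ Ψ (U ×ˢ V)) {x : E} (hx : x ∈ U) {z : G} (hz : z ∈ V) :
    HasFDerivAt (fun x => Ψ (x, z))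
      ((fderiv ℝ Ψ (x, z)).comp (ContinuousLinearMap.inl ℝ E G)) x := by
  have h1 : HasFDerivAt Ψ (fderiv ℝ Ψ (x, z)) (x, z) :=
    ((hΨ.contDiffAt ((hU.prod hV).mem_nhds ⟨hx, hz⟩)).differentiableAt (by simp)).hasFDerivAt
  exact h1.comp x (hasFDerivAt_prodMk_left x z)

/-- For each `z` the mean value inequality controls the remainder by the oscillation of the partial
derivative near `x`. That oscillation is small uniformly in `z`, because `continuousOn_restr`
applies to the partial derivative as well; hence differentiability in the sup norm. -/
theorem hasFDerivAt_restr {U : Set E} {V : Set G} (hU : IsOpen U) (hV : IsOpen V)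
    {M : Compacts G} (hM : (M : Set G) ⊆ V) {Ψ : E × G → W} (hΨ : ContDiffOn ℝ ∞ Ψ (U ×ˢ V))
    {x : E} (hx : x ∈ U) :
    HasFDerivAt (fun x => restr M fun z => Ψ (x, z))
      (swapCLM E W M (restr M fun z =>
        (fderiv ℝ Ψ (x, z)).comp (ContinuousLinearMap.inl ℝ E G))) x := by
  set D : E × G → E →L[ℝ] W := fun p => (fderiv ℝ Ψ p).comp (ContinuousLinearMap.inl ℝ E G)
    with hD
  have hDc : ContinuousOn D (U ×ˢ V) := by
    have := hΨ.continuousOn_fderiv_of_isOpen (hU.prod hV) (by simp)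
    exact this.clm_comp continuousOn_const
  have hc := continuousOn_restr hM hDc
  rw [hasFDerivAt_iff_isLittleO, Asymptotics.isLittleO_iff]
  -- One radius `δ` serves all `z`: continuity is used in the sup norm over `M`.
  intro η hη
  have h1 := (hc.continuousAt (hU.mem_nhds hx))
  obtain ⟨δ, hδ, hball⟩ := Metric.eventually_nhds_iff_ball.1
    ((Metric.tendsto_nhds.1 h1 η hη).and (hU.mem_nhds hx))
  filter_upwards [Metric.ball_mem_nhds x hδ] with y hy
  refine (ContinuousMap.norm_le _ (by positivity)).2 fun z => ?_
  have hyU : y ∈ U := (hball y hy).2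
  have e : (restr M (fun z => Ψ (y, z)) - restr M (fun z => Ψ (x, z))
      - swapCLM E W M (restr M fun z => D (x, z)) (y - x)) z
      = Ψ (y, z) - Ψ (x, z) - D (x, z) (y - x) := by
    rw [ContinuousMap.sub_apply, ContinuousMap.sub_apply, swapCLM_apply,
      restr_apply (continuousOn_slice hM hΨ.continuousOn hyU),
      restr_apply (continuousOn_slice hM hΨ.continuousOn hx),
      restr_apply (continuousOn_slice hM hDc hx)]
  refine (congrArg norm e).le.trans ?_
  refine (convex_ball x δ).norm_image_sub_le_of_norm_hasFDerivWithin_le' (f := fun y => Ψ (y, z))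
    (f' := fun y => D (y, z)) (φ := D (x, z)) (fun w hw => ?_) (fun w hw => ?_)
    (Metric.mem_ball_self hδ) hy
  · exact (hasFDerivAt_slice hU hV hΨ (hball w hw).2 (hM z.2)).hasFDerivWithinAt
  · have h2 := (hball w hw).1
    rw [dist_eq_norm] at h2
    refine le_trans ?_ h2.le
    have := ContinuousMap.norm_coe_le_norm
      ((restr M fun z => D (w, z)) - restr M fun z => D (x, z)) z
    rwa [ContinuousMap.sub_apply, restr_apply (continuousOn_slice hM hDc (hball w hw).2),
      restr_apply (continuousOn_slice hM hDc hx)] at this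

/-- The derivative of such a family is again such a family, with values in `E →L[ℝ] W`, followed by
the fixed linear map `swapCLM`. The induction therefore has to range over all target spaces `W`. -/
theorem contDiffOn_restr_nat {U : Set E} {V : Set G} (hU : IsOpen U) (hV : IsOpen V)
    {M : Compacts G} (hM : (M : Set G) ⊆ V) (n : ℕ) :
    ∀ (W : Type) [NormedAddCommGroup W] [NormedSpace ℝ W] (Ψ : E × G → W),
      ContDiffOn ℝ ∞ Ψ (U ×ˢ V) → ContDiffOn ℝ n (fun x => restr M fun z => Ψ (x, z)) U := by
  induction n with
  | zero =>
    intro W _ _ Ψ hΨ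
    exact contDiffOn_zero.2 (continuousOn_restr hM hΨ.continuousOn)
  | succ n ih =>
    intro W _ _ Ψ hΨ
    push_cast
    rw [contDiffOn_succ_iff_fderiv_of_isOpen hU]
    refine ⟨fun x hx => (hasFDerivAt_restr hU hV hM hΨ hx).differentiableAt.differentiableWithinAt,
      by simp, ?_⟩
    have h1 : ContDiffOn ℝ ∞ (fun p => (fderiv ℝ Ψ p).comp (ContinuousLinearMap.inl ℝ E G))
        (U ×ˢ V) :=
      (hΨ.fderiv_of_isOpen (hU.prod hV) (by simp)).clm_comp contDiffOn_const
    refine ((swapCLM E W M).contDiff.comp_contDiffOn (ih _ _ h1)).congr fun x hx => ?_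
    exact (hasFDerivAt_restr hU hV hM hΨ hx).fderiv

theorem contDiffOn_restr {U : Set E} {V : Set G} (hU : IsOpen U) (hV : IsOpen V)
    {M : Compacts G} (hM : (M : Set G) ⊆ V) {Ψ : E × G → W} (hΨ : ContDiffOn ℝ ∞ Ψ (U ×ˢ V)) :
    ContDiffOn ℝ ∞ (fun x => restr M fun z => Ψ (x, z)) U :=
  contDiffOn_infty.2 fun n => contDiffOn_restr_nat hU hV hM n W Ψ hΨ

theorem iteratedFDeriv_restr_apply {U : Set E} {V : Set G} (hU : IsOpen U) (hV : IsOpen V)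
    {M : Compacts G} (hM : (M : Set G) ⊆ V) {Ψ : E × G → W} (hΨ : ContDiffOn ℝ ∞ Ψ (U ×ˢ V))
    {x : E} (hx : x ∈ U) (j : ℕ) (m : Fin j → E) (z : M) :
    iteratedFDeriv ℝ j (fun x => restr M fun z => Ψ (x, z)) x m z
      = iteratedFDeriv ℝ j (fun x => Ψ (x, z)) x m := by
  have h := (ContinuousMap.evalCLM ℝ z : C(M, W) →L[ℝ] W).iteratedFDeriv_comp_left
    ((contDiffOn_restr hU hV hM hΨ).contDiffAt (hU.mem_nhds hx)) (i := j)
    (by exact_mod_cast le_top)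
  have h2 : (ContinuousMap.evalCLM ℝ z : C(M, W) →L[ℝ] W) ∘ (fun x => restr M fun z => Ψ (x, z))
      =ᶠ[nhds x] fun x => Ψ (x, z) := by
    filter_upwards [hU.mem_nhds hx] with y hy
    exact restr_apply (continuousOn_slice hM hΨ.continuousOn hy) z
  rw [(h2.iteratedFDeriv ℝ j).eq_of_nhds] at h
  rw [h]
  rfl

/-- Evaluation at `z` is linear and continuous, so it commutes with derivatives in `x`; these are
full derivatives precomposed with `inl`, whose norm is at most one. -/
theorem norm_iteratedFDeriv_restr_le {U : Set E} {V : Set G} (hU : IsOpen U) (hV : IsOpen V)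
    {M : Compacts G} (hM : (M : Set G) ⊆ V) {Ψ : E × G → W} (hΨ : ContDiffOn ℝ ∞ Ψ (U ×ˢ V))
    {x : E} (hx : x ∈ U) (j : ℕ) {C : ℝ} (hC : 0 ≤ C)
    (h : ∀ z ∈ M, ‖iteratedFDeriv ℝ j Ψ (x, z)‖ ≤ C) :
    ‖iteratedFDeriv ℝ j (fun x => restr M fun z => Ψ (x, z)) x‖ ≤ C := by
  refine ContinuousMultilinearMap.opNorm_le_bound hC fun m => ?_
  refine (ContinuousMap.norm_le _ (by positivity)).2 fun z => ?_
  rw [iteratedFDeriv_restr_apply hU hV hM hΨ hx]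
  refine (ContinuousMultilinearMap.le_opNorm _ m).trans
    (mul_le_mul_of_nonneg_right ?_ (by positivity))
  have e : (fun x => Ψ (x, (z : G)))
      = fun x => Ψ (ContinuousLinearMap.inl ℝ E G x + (0, (z : G))) := by
    ext x; simp
  rw [e]
  have e2 : ContinuousLinearMap.inl ℝ E G x + (0, (z : G)) = (x, (z : G)) := by simp
  refine (norm_iteratedFDeriv_comp_affine_le (hU.prod hV) hΨ _ _ ?_ j).trans ?_
  · rw [e2]; exact ⟨hx, hM z.2⟩
  · rw [e2]
    exact (mul_le_of_le_one_right (norm_nonneg _) (pow_le_one₀ (norm_nonneg _)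
      (ContinuousLinearMap.norm_inl_le_one ℝ E G))).trans (h z z.2)

end Slices

/-! ### Jets, and distributions as continuous linear forms in jets -/

section Jets

variable {E G : Type} [NormedAddCommGroup E] [NormedSpace ℝ E]
  [NormedAddCommGroup G] [NormedSpace ℝ G]

/-- The space of jets of order `k` of complex functions, at a fixed point. -/
def Jet (G : Type) [NormedAddCommGroup G] [NormedSpace ℝ G] (k : ℕ) : Type :=
  ∀ i : Fin (k + 1), G [×(i : ℕ)]→L[ℝ] ℂ

noncomputable instance (k : ℕ) : NormedAddCommGroup (Jet G k) :=
  inferInstanceAs (NormedAddCommGroup (∀ i : Fin (k + 1), G [×(i : ℕ)]→L[ℝ] ℂ))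

noncomputable instance (k : ℕ) : NormedSpace ℝ (Jet G k) :=
  inferInstanceAs (NormedSpace ℝ (∀ i : Fin (k + 1), G [×(i : ℕ)]→L[ℝ] ℂ))

noncomputable instance (k : ℕ) : NormedSpace ℂ (Jet G k) :=
  inferInstanceAs (NormedSpace ℂ (∀ i : Fin (k + 1), G [×(i : ℕ)]→L[ℝ] ℂ))

instance (k : ℕ) : IsScalarTower ℝ ℂ (Jet G k) :=
  inferInstanceAs (IsScalarTower ℝ ℂ (∀ i : Fin (k + 1), G [×(i : ℕ)]→L[ℝ] ℂ))

instance (k : ℕ) : CompleteSpace (Jet G k) :=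
  inferInstanceAs (CompleteSpace (∀ i : Fin (k + 1), G [×(i : ℕ)]→L[ℝ] ℂ))

/-- The component of order `i` of a jet. -/
noncomputable def Jet.proj (k : ℕ) (i : Fin (k + 1)) : Jet G k →L[ℝ] G [×(i : ℕ)]→L[ℝ] ℂ :=
  ContinuousLinearMap.proj (R := ℝ) (φ := fun i : Fin (k + 1) => G [×(i : ℕ)]→L[ℝ] ℂ) i

theorem Jet.norm_le_iff {k : ℕ} {w : Jet G k} {C : ℝ} (hC : 0 ≤ C) :
    ‖w‖ ≤ C ↔ ∀ i, ‖Jet.proj k i w‖ ≤ C :=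
  pi_norm_le_iff_of_nonneg (x := (w : ∀ i : Fin (k + 1), G [×(i : ℕ)]→L[ℝ] ℂ)) hC

theorem Jet.ext {k : ℕ} {w w' : Jet G k} (h : ∀ i, Jet.proj k i w = Jet.proj k i w') : w = w' :=
  funext h

theorem contDiff_jet_iff {k : ℕ} {f : E → Jet G k} :
    ContDiff ℝ ∞ f ↔ ∀ i, ContDiff ℝ ∞ fun x => Jet.proj k i (f x) :=
  contDiff_pi (Φ := fun x i => f x i)

/-- The derivatives of order at most `k`. -/
noncomputable def jet (k : ℕ) (f : G → ℂ) (z : G) : Jet G k := fun i => iteratedFDeriv ℝ i f z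

theorem Jet.proj_jet (k : ℕ) (i : Fin (k + 1)) (f : G → ℂ) (z : G) :
    Jet.proj k i (jet k f z) = iteratedFDeriv ℝ i f z := rfl

theorem contDiff_jet (k : ℕ) {f : G → ℂ} (hf : ContDiff ℝ ∞ f) : ContDiff ℝ ∞ (jet k f) :=
  contDiff_jet_iff.2 fun i => hf.iteratedFDeriv_right (i := i) (m := ∞) (by exact_mod_cast le_top)

theorem jet_add (k : ℕ) {f g : G → ℂ} (hf : ContDiff ℝ ∞ f) (hg : ContDiff ℝ ∞ g) (z : G) :
    jet k (fun z => f z + g z) z = jet k f z + jet k g z := by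
  refine Jet.ext fun i => ?_
  exact iteratedFDeriv_add_apply (hf.of_le (by exact_mod_cast le_top)).contDiffAt
    (hg.of_le (by exact_mod_cast le_top)).contDiffAt

theorem jet_smul (k : ℕ) {f : G → ℂ} (hf : ContDiff ℝ ∞ f) (c : ℂ) (z : G) :
    jet k (fun z => c • f z) z = c • jet k f z := by
  refine Jet.ext fun i => ?_
  exact iteratedFDeriv_const_smul_apply' (𝕜 := ℝ) (a := c) (hf.of_le (by exact_mod_cast le_top)).contDiffAt

/-- The jet on a compact set, as a continuous function. -/
noncomputable def jetOn (M : Compacts G) (k : ℕ) (f : G → ℂ) : C(M, Jet G k) := restr M (jet k f)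

theorem jetOn_apply {M : Compacts G} {k : ℕ} {f : G → ℂ} (hf : ContDiff ℝ ∞ f) (z : M) :
    jetOn M k f z = jet k f z :=
  restr_apply (contDiff_jet k hf).continuous.continuousOn z

theorem jetOn_add (M : Compacts G) (k : ℕ) {f g : G → ℂ} (hf : ContDiff ℝ ∞ f)
    (hg : ContDiff ℝ ∞ g) :
    jetOn M k (fun z => f z + g z) = jetOn M k f + jetOn M k g := by
  ext1 z
  rw [jetOn_apply (hf.add hg), ContinuousMap.add_apply, jetOn_apply hf, jetOn_apply hg,
    jet_add k hf hg]

theorem jetOn_smul (M : Compacts G) (k : ℕ) {f : G → ℂ} (hf : ContDiff ℝ ∞ f) (c : ℂ) :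
    jetOn M k (fun z => c • f z) = c • jetOn M k f := by
  ext1 z
  rw [jetOn_apply (hf.const_smul c), ContinuousMap.smul_apply, jetOn_apply hf, jet_smul k hf]

theorem jetOn_sub (M : Compacts G) (k : ℕ) {f g : G → ℂ} (hf : ContDiff ℝ ∞ f)
    (hg : ContDiff ℝ ∞ g) :
    jetOn M k (fun z => f z - g z) = jetOn M k f - jetOn M k g := by
  have h := jetOn_add M k hf (hg.const_smul (-1 : ℂ))
  rw [jetOn_smul M k hg, neg_one_smul ℂ, ← sub_eq_add_neg] at h
  rw [← h]
  congr 1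
  ext z
  simp [sub_eq_add_neg]

/-- The partial jet in the second variable. -/
noncomputable def partialJet (k : ℕ) (Φ : E × G → ℂ) (p : E × G) : Jet G k :=
  jet k (fun z => Φ (p.1, z)) p.2

theorem partialJet_apply (k : ℕ) {Φ : E × G → ℂ} (hΦ : ContDiff ℝ ∞ Φ) (p : E × G)
    (i : Fin (k + 1)) :
    Jet.proj k i (partialJet k Φ p) = ContinuousMultilinearMap.compContinuousLinearMapL (𝕜 := ℝ) (F := ℂ)
      (fun _ : Fin i => ContinuousLinearMap.inr ℝ E G) (iteratedFDeriv ℝ i Φ p) := by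
  have e : (fun z => Φ (p.1, z)) = fun z => Φ (ContinuousLinearMap.inr ℝ E G z + (p.1, 0)) := by
    ext z; simp
  have e2 : ContinuousLinearMap.inr ℝ E G p.2 + (p.1, 0) = p := by simp
  have h := iteratedFDeriv_comp_affine isOpen_univ hΦ.contDiffOn
    (ContinuousLinearMap.inr ℝ E G) (p.1, 0) (x := p.2) (mem_univ _) i
  rw [e2] at h
  change iteratedFDeriv ℝ i (fun z => Φ (p.1, z)) p.2 = _
  rw [e, h]
  rfl

theorem contDiff_partialJet_apply (k : ℕ) {Φ : E × G → ℂ} (hΦ : ContDiff ℝ ∞ Φ)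
    (i : Fin (k + 1)) : ContDiff ℝ ∞ fun p => Jet.proj k i (partialJet k Φ p) := by
  simp_rw [partialJet_apply k hΦ]
  exact (ContinuousLinearMap.contDiff _).comp
    (hΦ.iteratedFDeriv_right (i := i) (m := ∞) (by exact_mod_cast le_top))

theorem contDiff_partialJet (k : ℕ) {Φ : E × G → ℂ} (hΦ : ContDiff ℝ ∞ Φ) :
    ContDiff ℝ ∞ (partialJet k Φ) :=
  contDiff_jet_iff.2 fun i => contDiff_partialJet_apply k hΦ i

/-- Each component of the partial jet is a full derivative of `Φ` followed by precomposition with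
`inr`, a linear operation of norm at most one. So `j` further derivatives of the component of order
`i` cost only the derivative of order `i + j`. -/
theorem norm_iteratedFDeriv_partialJet_le (k j : ℕ) {Φ : E × G → ℂ} (hΦ : ContDiff ℝ ∞ Φ)
    (p : E × G) {C : ℝ} (hC : 0 ≤ C)
    (h : ∀ i ≤ k, ‖iteratedFDeriv ℝ (i + j) Φ p‖ ≤ C) :
    ‖iteratedFDeriv ℝ j (partialJet k Φ) p‖ ≤ C := by
  refine ContinuousMultilinearMap.opNorm_le_bound hC fun m => ?_
  refine (Jet.norm_le_iff (by positivity)).2 fun i => ?_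
  have h1 := (Jet.proj (G := G) k i).iteratedFDeriv_comp_left
    (contDiff_partialJet k hΦ).contDiffAt (x := p) (i := j) (by exact_mod_cast le_top)
  have h2 : Jet.proj k i (iteratedFDeriv ℝ j (partialJet k Φ) p m)
      = iteratedFDeriv ℝ j (fun p => Jet.proj k i (partialJet k Φ p)) p m := by
    have := congrArg (fun A => A m) h1
    exact this.symm
  rw [h2]
  refine (ContinuousMultilinearMap.le_opNorm _ m).trans
    (mul_le_mul_of_nonneg_right ?_ (by positivity))
  simp_rw [partialJet_apply k hΦ]
  set Q := ContinuousMultilinearMap.compContinuousLinearMapL (𝕜 := ℝ) (F := ℂ)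
      (fun _ : Fin i => ContinuousLinearMap.inr ℝ E G) with hQ
  have h3 := Q.iteratedFDeriv_comp_left
    (hΦ.iteratedFDeriv_right (i := i) (m := ∞) (by exact_mod_cast le_top)).contDiffAt (x := p) (i := j)
    (by exact_mod_cast le_top)
  change ‖iteratedFDeriv ℝ j (Q ∘ iteratedFDeriv ℝ i Φ) p‖ ≤ C
  rw [h3]
  refine (ContinuousLinearMap.norm_compContinuousMultilinearMap_le _ _).trans ?_
  rw [norm_iteratedFDeriv_iteratedFDeriv]
  have hQ1 : ‖Q‖ ≤ 1 := by
    refine (ContinuousMultilinearMap.norm_compContinuousLinearMapL_le _ _).trans ?_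
    simp only [Finset.prod_const]
    exact pow_le_one₀ (norm_nonneg _) (ContinuousLinearMap.norm_inr_le_one ℝ E G)
  exact (mul_le_of_le_one_left (norm_nonneg _) hQ1).trans (h i (Nat.lt_succ_iff.1 i.2))

theorem contDiff_jetOn (M : Compacts G) (k : ℕ) {Φ : E × G → ℂ} (hΦ : ContDiff ℝ ∞ Φ) :
    ContDiff ℝ ∞ fun x => jetOn M k fun z => Φ (x, z) :=
  contDiffOn_univ.1 (contDiffOn_restr (U := univ) (V := univ) (Ψ := partialJet k Φ) isOpen_univ
    isOpen_univ (subset_univ _) (contDiff_partialJet k hΦ).contDiffOn)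

theorem norm_iteratedFDeriv_jetOn_le (M : Compacts G) (k j : ℕ) {Φ : E × G → ℂ}
    (hΦ : ContDiff ℝ ∞ Φ) (x : E) {C : ℝ} (hC : 0 ≤ C)
    (h : ∀ z ∈ M, ∀ i ≤ k, ‖iteratedFDeriv ℝ (i + j) Φ (x, z)‖ ≤ C) :
    ‖iteratedFDeriv ℝ j (fun x => jetOn M k fun z => Φ (x, z)) x‖ ≤ C :=
  norm_iteratedFDeriv_restr_le (U := univ) (V := univ) (Ψ := partialJet k Φ) isOpen_univ
    isOpen_univ (subset_univ _) (contDiff_partialJet k hΦ).contDiffOn (mem_univ x) j hC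
    fun z hz => norm_iteratedFDeriv_partialJet_le k j hΦ _ hC (h z hz)

theorem norm_iteratedFDeriv_le_norm_jetOn {M : Compacts G} {k i : ℕ} {f : G → ℂ}
    (hf : ContDiff ℝ ∞ f) (hi : i ≤ k) {z : G} (hz : z ∈ M) :
    ‖iteratedFDeriv ℝ i f z‖ ≤ ‖jetOn M k f‖ := by
  have h1 := (jetOn M k f).norm_coe_le_norm ⟨z, hz⟩
  rw [jetOn_apply hf] at h1
  have h2 := (Jet.norm_le_iff (norm_nonneg (jetOn M k f))).1 h1 ⟨i, Nat.lt_succ_of_le hi⟩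
  rwa [Jet.proj_jet] at h2

/-- A distribution restricted to the test functions supported in a compact set is a continuous
linear form in the jets of some finite order. -/
theorem exists_jet_extension {Ω : Opens G} (T : Distrib Ω) (M : Compacts G)
    (hM : (M : Set G) ⊆ Ω) :
    ∃ (k : ℕ) (S : C(M, Jet G k) →L[ℂ] ℂ), ∀ φ : 𝓓(Ω, ℂ), tsupport φ ⊆ M →
      T φ = S (jetOn M k φ) := by
  obtain ⟨T', hT'⟩ : ∃ T' : 𝓓_{M}(G, ℂ) →L[ℂ] ℂ, ∀ φ, T' φ = T (TestFunction.ofSupportedIn hM φ) :=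
    ⟨T ∘L TestFunction.ofSupportedInCLM ℂ hM, fun _ => rfl⟩
  obtain ⟨s, C, -, hC⟩ := Seminorm.bound_of_continuous
    (ContDiffMapSupportedIn.withSeminorms ℂ G ℂ ⊤ M)
    ((normSeminorm ℂ ℂ).comp T'.toLinearMap) T'.continuous.norm
  -- Continuity bounds `T'` by finitely many seminorms; `k` is the largest order among them.
  set k := s.sup id with hk
  obtain ⟨J, hJ⟩ : ∃ J : 𝓓_{M}(G, ℂ) →ₗ[ℂ] C(M, Jet G k), ∀ φ, J φ = jetOn M k φ :=
    ⟨{ toFun := fun φ => jetOn M k φ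
       map_add' := fun φ ψ => jetOn_add M k φ.contDiff ψ.contDiff
       map_smul' := fun c φ => jetOn_smul M k φ.contDiff c }, fun _ => rfl⟩
  -- The component of order zero recovers `φ` on `M`, and `φ` vanishes elsewhere. Injectivity lets
  -- `T'` be transported to the range of `J`.
  have hinj : Function.Injective J := by
    rw [← LinearMap.ker_eq_bot, LinearMap.ker_eq_bot']
    intro φ hφ
    ext z
    by_cases hz : z ∈ M
    · have h := norm_iteratedFDeriv_le_norm_jetOn (M := M) φ.contDiff (Nat.zero_le k) hz
      rw [← hJ, hφ, norm_zero, norm_iteratedFDeriv_zero] at h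
      simpa using h
    · exact φ.zero_on_compl hz
  have hbound : ∀ φ, ‖T' φ‖ ≤ C * ‖J φ‖ := by
    intro φ
    have h1 : ‖T' φ‖ ≤ C * (s.sup (ContDiffMapSupportedIn.seminorm ℂ G ℂ ⊤ M)) φ := hC φ
    refine h1.trans (mul_le_mul_of_nonneg_left ?_ C.2)
    rw [hJ]
    refine Seminorm.finset_sup_apply_le (norm_nonneg (jetOn M k φ)) fun i hi => ?_
    exact (ContDiffMapSupportedIn.seminorm_le_iff ℂ (norm_nonneg (jetOn M k φ)) i φ).2
      fun _ z hz => norm_iteratedFDeriv_le_norm_jetOn φ.contDiff (Finset.le_sup (f := id) hi) hz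
  obtain ⟨e, he⟩ : ∃ e : 𝓓_{M}(G, ℂ) ≃ₗ[ℂ] LinearMap.range J,
      ∀ φ, ((e φ : LinearMap.range J) : C(M, Jet G k)) = J φ :=
    ⟨LinearEquiv.ofInjective J hinj, fun _ => rfl⟩
  obtain ⟨f, hf⟩ : ∃ f : StrongDual ℂ (LinearMap.range J), ∀ φ, f (e φ) = T' φ := by
    refine ⟨(T'.toLinearMap ∘ₗ e.symm.toLinearMap).mkContinuous C fun y => ?_, fun φ => ?_⟩
    · obtain ⟨φ, rfl⟩ := e.surjective y
      change ‖T' (e.symm (e φ))‖ ≤ C * ‖((e φ : LinearMap.range J) : C(M, Jet G k))‖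
      rw [e.symm_apply_apply, he]
      exact hbound φ
    · change T' (e.symm (e φ)) = T' φ
      rw [e.symm_apply_apply]
  -- Hahn–Banach: the form is bounded on the range of `J` for the sup norm by `hbound`.
  obtain ⟨S, hS, -⟩ := exists_extension_norm_eq (LinearMap.range J) f
  refine ⟨k, S, fun φ hφ => ?_⟩
  obtain ⟨φ', hφ'⟩ : ∃ φ' : 𝓓_{M}(G, ℂ), (φ' : G → ℂ) = φ :=
    ⟨ContDiffMapSupportedIn.of_support_subset φ.contDiff ((subset_tsupport _).trans hφ), rfl⟩
  have h1 := hS (e φ')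
  rw [hf, he, hJ, hφ', hT'] at h1
  rw [h1]
  congr 1
  ext z
  exact (congrFun hφ' z).symm

end Jets

/-! ### Integrals over a compact set depending on parameters -/

section Integrals

variable {G F : Type} [NormedAddCommGroup G] [NormedSpace ℝ G]
  [NormedAddCommGroup F] [NormedSpace ℝ F] [MeasurableSpace F] [BorelSpace F]

/-- Integration over a compact set, as a continuous linear form on continuous functions. -/
theorem exists_integral_clm (μ : Measure F) [IsFiniteMeasureOnCompacts μ] (L : Compacts F) :
    ∃ I : C(L, ℂ) →L[ℝ] ℂ, ‖I‖ ≤ μ.real L ∧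
      ∀ (f : C(L, ℂ)) (g : F → ℂ), (∀ y : L, f y = g y) → I f = ∫ y in L, g y ∂μ := by
  set ν : Measure L := μ.comap Subtype.val with hν
  have hm : MeasurableSet (L : Set F) := L.isCompact.isClosed.measurableSet
  have hνu : ν univ = μ L := by
    refine ((MeasurableEmbedding.subtype_coe hm).comap_apply μ univ).trans ?_
    congr 1
    ext x; simp
  have : IsFiniteMeasure ν := ⟨by rw [hνu]; exact L.isCompact.measure_lt_top⟩
  have hi : ∀ f : C(L, ℂ), Integrable f ν := fun f =>
    f.continuous.integrable_of_hasCompactSupport (HasCompactSupport.of_compactSpace _)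
  let I₀ : C(L, ℂ) →ₗ[ℝ] ℂ :=
    { toFun := fun f => ∫ y, f y ∂ν
      map_add' := fun f g => integral_add (hi f) (hi g)
      map_smul' := fun c f => integral_smul c (fun y => f y) }
  have hb : ∀ f, ‖I₀ f‖ ≤ μ.real L * ‖f‖ := fun f => by
    have h := norm_integral_le_of_norm_le_const (μ := ν) (f := f) (C := ‖f‖)
      (Filter.Eventually.of_forall f.norm_coe_le_norm)
    rw [mul_comm, measureReal_def, ← hνu]
    exact h
  refine ⟨I₀.mkContinuous _ hb, I₀.mkContinuous_norm_le measureReal_nonneg hb, fun f g h => ?_⟩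
  change ∫ y, f y ∂ν = _
  simp_rw [h]
  exact integral_subtype_comap hm g

variable (μ : Measure F) [IsFiniteMeasureOnCompacts μ]
    (L : Compacts F) {U : Set G} {V : Set F} (hU : IsOpen U) (hV : IsOpen V)
    (hL : (L : Set F) ⊆ V) {Φ : G × F → ℂ} (hΦ : ContDiffOn ℝ ∞ Φ (U ×ˢ V))

include hU hV hL hΦ

/-- Integration over `L` is a bounded linear form on `C(L, ℂ)`, composed here with a smooth family.
The next two results, on derivatives and their bounds, come from the same factorisation. -/
theorem contDiffOn_integral : ContDiffOn ℝ ∞ (fun z => ∫ y in L, Φ (z, y) ∂μ) U := by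
  obtain ⟨I, -, hI⟩ := exists_integral_clm μ L
  refine (I.contDiff.comp_contDiffOn (contDiffOn_restr hU hV hL hΦ)).congr fun z hz => ?_
  exact (hI _ _ fun y => restr_apply (continuousOn_slice hL hΦ.continuousOn hz) y).symm

theorem iteratedFDeriv_integral_apply {z : G} (hz : z ∈ U) (i : ℕ) (m : Fin i → G) :
    iteratedFDeriv ℝ i (fun z => ∫ y in L, Φ (z, y) ∂μ) z m
      = ∫ y in L, iteratedFDeriv ℝ i (fun z => Φ (z, y)) z m ∂μ := by
  obtain ⟨I, -, hI⟩ := exists_integral_clm μ L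
  have h1 : (fun z => ∫ y in L, Φ (z, y) ∂μ) =ᶠ[nhds z]
      I ∘ fun z => restr L fun y => Φ (z, y) := by
    filter_upwards [hU.mem_nhds hz] with w hw
    exact (hI _ _ fun y => restr_apply (continuousOn_slice hL hΦ.continuousOn hw) y).symm
  rw [(h1.iteratedFDeriv ℝ i).eq_of_nhds, I.iteratedFDeriv_comp_left
    ((contDiffOn_restr hU hV hL hΦ).contDiffAt (hU.mem_nhds hz)) (by exact_mod_cast le_top)]
  exact hI _ _ fun y => iteratedFDeriv_restr_apply hU hV hL hΦ hz i m y

theorem norm_iteratedFDeriv_integral_le {z : G} (hz : z ∈ U) (i : ℕ) {C : ℝ} (hC : 0 ≤ C)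
    (h : ∀ y ∈ L, ‖iteratedFDeriv ℝ i Φ (z, y)‖ ≤ C) :
    ‖iteratedFDeriv ℝ i (fun z => ∫ y in L, Φ (z, y) ∂μ) z‖ ≤ μ.real L * C := by
  obtain ⟨I, hI0, hI⟩ := exists_integral_clm μ L
  have h1 : (fun z => ∫ y in L, Φ (z, y) ∂μ) =ᶠ[nhds z]
      I ∘ fun z => restr L fun y => Φ (z, y) := by
    filter_upwards [hU.mem_nhds hz] with w hw
    exact (hI _ _ fun y => restr_apply (continuousOn_slice hL hΦ.continuousOn hw) y).symm
  rw [(h1.iteratedFDeriv ℝ i).eq_of_nhds, I.iteratedFDeriv_comp_left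
    ((contDiffOn_restr hU hV hL hΦ).contDiffAt (hU.mem_nhds hz)) (by exact_mod_cast le_top)]
  refine (ContinuousLinearMap.norm_compContinuousMultilinearMap_le _ _).trans ?_
  exact mul_le_mul hI0 (norm_iteratedFDeriv_restr_le hU hV hL hΦ hz i hC h) (norm_nonneg _)
    measureReal_nonneg

omit hU hV hL hΦ

/-- The continuous form `S` commutes with the Bochner integral in `C(M, Jet G k)`. That integral is
then identified with the jet of the integrated function by differentiating under the integral sign.
-/
theorem integral_jetOn {M : Compacts G} {k : ℕ} (S : C(M, Jet G k) →L[ℂ] ℂ)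
    {Φ : G × F → ℂ} (hΦ : ContDiff ℝ ∞ Φ) :
    ∫ y in L, S (jetOn M k fun z => Φ (z, y)) ∂μ
      = S (jetOn M k fun z => ∫ y in L, Φ (z, y) ∂μ) := by
  have hsw : ContDiff ℝ ∞ fun p : F × G => Φ (p.2, p.1) := hΦ.comp (contDiff_snd.prodMk contDiff_fst)
  have hc : Continuous fun y => jetOn M k fun z => Φ (z, y) := (contDiff_jetOn M k hsw).continuous
  have hint : IntegrableOn (fun y => jetOn M k fun z => Φ (z, y)) L μ :=
    hc.continuousOn.integrableOn_compact L.isCompact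
  rw [S.integral_comp_comm hint]
  congr 1
  have hΦ' : ContDiffOn ℝ ∞ Φ (univ ×ˢ univ) := hΦ.contDiffOn
  have hI : ContDiff ℝ ∞ fun z => ∫ y in L, Φ (z, y) ∂μ :=
    contDiffOn_univ.1 (contDiffOn_integral μ L isOpen_univ isOpen_univ (subset_univ _) hΦ')
  refine ContinuousMap.ext fun z => Jet.ext fun i => ContinuousMultilinearMap.ext fun m => ?_
  -- The forms "component of order `i` at `z`, on the vectors `m`" separate the elements of `C(M,
  -- Jet G k)`.
  let ev : C(M, Jet G k) →L[ℝ] ℂ :=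
    (ContinuousMultilinearMap.apply ℝ (fun _ : Fin i => G) ℂ m).comp
      ((Jet.proj k i).comp (ContinuousMap.evalCLM ℝ z))
  have h1 := ev.integral_comp_comm hint
  have hy : ∀ y, ev (jetOn M k fun z => Φ (z, y))
      = iteratedFDeriv ℝ i (fun z => Φ (z, y)) z m := fun y => by
    change Jet.proj k i (jetOn M k (fun z => Φ (z, y)) z) m = _
    rw [jetOn_apply (f := fun z => Φ (z, y)) (hΦ.comp (contDiff_prodMk_left y)), Jet.proj_jet]
  simp_rw [hy] at h1
  rw [jetOn_apply hI, Jet.proj_jet, iteratedFDeriv_integral_apply μ L isOpen_univ isOpen_univ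
    (subset_univ _) hΦ' (mem_univ _), h1]
  rfl

end Integrals

/-! ### Nets controlled uniformly on the whole space, and estimates for `Θ_ε` -/

section UniformNets

variable {E G : Type} [NormedAddCommGroup E] [NormedSpace ℝ E]
  [NormedAddCommGroup G] [NormedSpace ℝ G]

theorem Eps.pos (ε : Eps) : (0 : ℝ) < ε := ε.2.1

theorem Eps.le_one (ε : Eps) : (ε : ℝ) ≤ 1 := ε.2.2

/-- The derivatives of order `i` are `O(ε ^ e)`, uniformly on the whole space and in `ε`. -/
def UnifBigO (i : ℕ) (u : Net E) (e : ℤ) : Prop :=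
  ∃ C : ℝ, 0 ≤ C ∧ ∀ (ε : Eps) (x : E), ‖iteratedFDeriv ℝ i (u ε) x‖ ≤ C * (ε : ℝ) ^ e

/-- Nets of smooth functions with uniformly moderate derivatives. -/
def UnifModerate (u : Net E) : Prop :=
  (∀ ε, ContDiff ℝ ∞ (u ε)) ∧ ∀ i, ∃ N : ℕ, UnifBigO i u (-(N : ℤ))

/-- Nets of smooth functions with uniformly negligible derivatives. -/
def UnifNegligible (u : Net E) : Prop :=
  (∀ ε, ContDiff ℝ ∞ (u ε)) ∧ ∀ (i N : ℕ), UnifBigO i u (N : ℤ)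

theorem UnifBigO.mono {i : ℕ} {u : Net E} {e e' : ℤ} (h : UnifBigO i u e) (he : e' ≤ e) :
    UnifBigO i u e' := by
  obtain ⟨C, hC, H⟩ := h
  exact ⟨C, hC, fun ε x => (H ε x).trans (mul_le_mul_of_nonneg_left
    (zpow_le_zpow_right_of_le_one₀ ε.pos ε.le_one he) hC)⟩

theorem UnifModerate.exists_common {u : Net E} (hu : UnifModerate u) (l : ℕ) :
    ∃ N : ℕ, ∀ i ≤ l, UnifBigO i u (-(N : ℤ)) := by
  choose N hN using hu.2
  refine ⟨∑ i ∈ Finset.range (l + 1), N i, fun i hi => (hN i).mono ?_⟩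
  have : N i ≤ ∑ i ∈ Finset.range (l + 1), N i :=
    Finset.single_le_sum (f := N) (fun j _ => Nat.zero_le _)
      (Finset.mem_range.2 (Nat.lt_succ_of_le hi))
  omega

theorem UnifBigO.mul {u v : Net E} (hu : ∀ ε, ContDiff ℝ ∞ (u ε)) (hv : ∀ ε, ContDiff ℝ ∞ (v ε))
    {i : ℕ} {a b : ℤ} (ha : ∀ j ≤ i, UnifBigO j u a) (hb : ∀ j ≤ i, UnifBigO j v b) :
    UnifBigO i (fun ε x => u ε x * v ε x) (a + b) := by
  choose! C hC0 hC using ha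
  choose! D hD0 hD using hb
  refine ⟨∑ j ∈ Finset.range (i + 1), (i.choose j : ℝ) * C j * D (i - j),
    Finset.sum_nonneg fun j hj => ?_, fun ε x => ?_⟩
  · have hj' : j ≤ i := Nat.lt_succ_iff.1 (Finset.mem_range.1 hj)
    exact mul_nonneg (mul_nonneg (Nat.cast_nonneg _) (hC0 j hj')) (hD0 _ (Nat.sub_le _ _))
  · refine (norm_iteratedFDeriv_mul_le (N := ∞) (hu ε) (hv ε) x (n := i)
      (by exact_mod_cast le_top)).trans ?_
    rw [Finset.sum_mul]
    refine Finset.sum_le_sum fun j hj => ?_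
    have hj' : j ≤ i := Nat.lt_succ_iff.1 (Finset.mem_range.1 hj)
    rw [zpow_add₀ ε.pos.ne']
    refine (mul_le_mul (mul_le_mul_of_nonneg_left (hC j hj' ε x) (Nat.cast_nonneg _))
      (hD (i - j) (Nat.sub_le _ _) ε x) (norm_nonneg _) (mul_nonneg (Nat.cast_nonneg _)
        (mul_nonneg (hC0 j hj') (zpow_pos ε.pos _).le))).trans_eq ?_
    ring

theorem UnifModerate.mul {u v : Net E} (hu : UnifModerate u) (hv : UnifModerate v) :
    UnifModerate fun ε x => u ε x * v ε x := by
  refine ⟨fun ε => (hu.1 ε).mul (hv.1 ε), fun i => ?_⟩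
  obtain ⟨N, hN⟩ := hu.exists_common i
  obtain ⟨M, hM⟩ := hv.exists_common i
  refine ⟨N + M, (UnifBigO.mul hu.1 hv.1 hN hM).mono ?_⟩
  push_cast
  omega

theorem UnifModerate.mul_negligible {u v : Net E} (hu : UnifModerate u) (hv : UnifNegligible v) :
    UnifNegligible fun ε x => u ε x * v ε x := by
  refine ⟨fun ε => (hu.1 ε).mul (hv.1 ε), fun i N => ?_⟩
  obtain ⟨M, hM⟩ := hu.exists_common i
  refine (UnifBigO.mul hu.1 hv.1 hM (fun j _ => hv.2 j (M + N))).mono ?_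
  push_cast
  omega

theorem UnifNegligible.add {u v : Net E} (hu : UnifNegligible u) (hv : UnifNegligible v) :
    UnifNegligible fun ε x => u ε x + v ε x := by
  refine ⟨fun ε => (hu.1 ε).add (hv.1 ε), fun i N => ?_⟩
  obtain ⟨C, hC0, hC⟩ := hu.2 i N
  obtain ⟨D, hD0, hD⟩ := hv.2 i N
  refine ⟨C + D, add_nonneg hC0 hD0, fun ε x => ?_⟩
  have h : iteratedFDeriv ℝ i (fun x => u ε x + v ε x) x
      = iteratedFDeriv ℝ i (u ε) x + iteratedFDeriv ℝ i (v ε) x :=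
    iteratedFDeriv_add_apply ((hu.1 ε).of_le (by exact_mod_cast le_top)).contDiffAt
      ((hv.1 ε).of_le (by exact_mod_cast le_top)).contDiffAt
  rw [h, add_mul]
  exact (norm_add_le _ _).trans (add_le_add (hC ε x) (hD ε x))

theorem UnifBigO.comp_clm {u : Net G} (hu : ∀ ε, ContDiff ℝ ∞ (u ε)) (A : E →L[ℝ] G) {i : ℕ}
    {e : ℤ} (h : UnifBigO i u e) : UnifBigO i (fun ε x => u ε (A x)) e := by
  obtain ⟨C, hC0, hC⟩ := h
  refine ⟨C * ‖A‖ ^ i, by positivity, fun ε x => ?_⟩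
  have h1 := norm_iteratedFDeriv_comp_affine_le isOpen_univ (hu ε).contDiffOn A 0 (x := x)
    (mem_univ _) i
  simp only [add_zero] at h1
  refine h1.trans ?_
  rw [mul_right_comm]
  exact mul_le_mul_of_nonneg_right (hC ε _) (by positivity)

theorem UnifModerate.comp_clm {u : Net G} (hu : UnifModerate u) (A : E →L[ℝ] G) :
    UnifModerate fun ε x => u ε (A x) :=
  ⟨fun ε => (hu.1 ε).comp A.contDiff, fun i => (hu.2 i).imp fun _ h => h.comp_clm hu.1 A⟩

theorem UnifNegligible.comp_clm {u : Net G} (hu : UnifNegligible u) (A : E →L[ℝ] G) :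
    UnifNegligible fun ε x => u ε (A x) :=
  ⟨fun ε => (hu.1 ε).comp A.contDiff, fun i N => (hu.2 i N).comp_clm hu.1 A⟩

/-- Smooth functions all of whose derivatives are bounded. -/
def BddDerivs {W : Type} [NormedAddCommGroup W] [NormedSpace ℝ W] (f : E → W) : Prop :=
  ContDiff ℝ ∞ f ∧ ∀ i : ℕ, ∃ C : ℝ, 0 ≤ C ∧ ∀ x, ‖iteratedFDeriv ℝ i f x‖ ≤ C

theorem BddDerivs.of_hasCompactSupport {f : E → ℂ} (hf : ContDiff ℝ ∞ f)
    (hc : HasCompactSupport f) : BddDerivs f := by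
  refine ⟨hf, fun i => ?_⟩
  obtain ⟨C, hC⟩ := Continuous.bounded_above_of_compact_support
    (hf.continuous_iteratedFDeriv (m := i) (by exact_mod_cast le_top)) (hc.iteratedFDeriv i)
  exact ⟨|C|, abs_nonneg C, fun y => (hC y).trans (le_abs_self C)⟩

theorem BddDerivs.unifModerate {f : E → ℂ} (hf : BddDerivs f) : UnifModerate fun _ => f := by
  refine ⟨fun _ => hf.1, fun i => ⟨0, ?_⟩⟩
  obtain ⟨C, hC0, hC⟩ := hf.2 i
  exact ⟨C, hC0, fun ε x => by simpa using hC x⟩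

theorem bddDerivs_const (c : ℂ) : BddDerivs fun _ : E => c := by
  refine ⟨contDiff_const, fun i => ?_⟩
  rcases Nat.eq_zero_or_pos i with rfl | hi
  · exact ⟨‖c‖, norm_nonneg c, fun x => by rw [norm_iteratedFDeriv_zero]⟩
  · refine ⟨0, le_rfl, fun x => ?_⟩
    rw [iteratedFDeriv_const_of_ne hi.ne']
    simp

theorem BddDerivs.sub {f g : E → ℂ} (hf : BddDerivs f) (hg : BddDerivs g) :
    BddDerivs fun x => f x - g x := by
  refine ⟨hf.1.sub hg.1, fun i => ?_⟩
  obtain ⟨C, hC0, hC⟩ := hf.2 i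
  obtain ⟨D, hD0, hD⟩ := hg.2 i
  refine ⟨C + D, add_nonneg hC0 hD0, fun x => ?_⟩
  have h : iteratedFDeriv ℝ i (fun x => f x - g x) x
      = iteratedFDeriv ℝ i f x - iteratedFDeriv ℝ i g x :=
    iteratedFDeriv_sub_apply (hf.1.of_le (by exact_mod_cast le_top)).contDiffAt
      (hg.1.of_le (by exact_mod_cast le_top)).contDiffAt
  rw [h]
  exact (norm_sub_le _ _).trans (add_le_add (hC x) (hD x))

theorem bddDerivs_schwartz (ρ : 𝓢(E, ℂ)) : BddDerivs ρ := by
  refine ⟨ρ.smooth ⊤, fun i => ?_⟩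
  obtain ⟨C, hC⟩ := ρ.decay 0 i
  exact ⟨C, hC.1.le, fun x => by simpa using hC.2 x⟩

theorem Eps.abs_log_le (ε : Eps) : |Real.log ε| ≤ (ε : ℝ)⁻¹ := by
  rw [abs_of_nonpos (Real.log_nonpos ε.pos.le ε.le_one), ← Real.log_inv]
  exact (Real.log_le_sub_one_of_pos (inv_pos.2 ε.pos)).trans (by linarith)

/-- With `s = √ε` one has `|ln ε| = 2 |ln s| ≤ 2 / s`, hence `ε |ln ε| ≤ 2 s`. The squared form
avoids fractional powers of `ε`. -/
theorem Eps.mul_abs_log_sq_le (ε : Eps) : ((ε : ℝ) * |Real.log ε|) ^ 2 ≤ 4 * ε := by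
  set s : ℝ := Real.sqrt ε with hs
  have hs0 : 0 < s := Real.sqrt_pos.2 ε.pos
  have hs1 : s ≤ 1 := Real.sqrt_le_one.2 ε.le_one
  have hss : (ε : ℝ) = s ^ 2 := (Real.sq_sqrt ε.pos.le).symm
  have h1 : |Real.log s| ≤ s⁻¹ := Eps.abs_log_le ⟨s, hs0, hs1⟩
  rw [hss, Real.log_pow, abs_mul]
  push_cast
  rw [abs_two]
  have h2 : s ^ 2 * (2 * |Real.log s|) ≤ 2 * s := by
    calc s ^ 2 * (2 * |Real.log s|) ≤ s ^ 2 * (2 * s⁻¹) := by gcongr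
      _ = 2 * s := by field_simp
  calc (s ^ 2 * (2 * |Real.log s|)) ^ 2 ≤ (2 * s) ^ 2 := by gcongr
    _ = 4 * s ^ 2 := by ring

theorem norm_iteratedFDeriv_dilation {f : E → ℂ} (hf : ContDiff ℝ ∞ f) (a : ℝ) (i : ℕ) (x : E) :
    ‖iteratedFDeriv ℝ i (fun x => f (a • x)) x‖ = |a| ^ i * ‖iteratedFDeriv ℝ i f (a • x)‖ := by
  have h := congrFun (iteratedFDeriv_comp_const_smul (i := i) a
    (hf.of_le (by exact_mod_cast le_top))) x
  rw [h, norm_smul, norm_pow, Real.norm_eq_abs]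

theorem unifModerate_dilation {f : E → ℂ} (hf : BddDerivs f) {a : Eps → ℝ}
    (ha : ∀ ε : Eps, |a ε| ≤ (ε : ℝ)⁻¹) : UnifModerate fun ε x => f (a ε • x) := by
  refine ⟨fun ε => hf.1.comp (contDiff_const_smul _), fun i => ⟨i, ?_⟩⟩
  obtain ⟨C, hC0, hC⟩ := hf.2 i
  refine ⟨C, hC0, fun ε x => ?_⟩
  rw [norm_iteratedFDeriv_dilation hf.1, zpow_neg, zpow_natCast, ← inv_pow, mul_comm]
  exact mul_le_mul (hC _) (pow_le_pow_left₀ (abs_nonneg _) (ha ε) i) (by positivity) hC0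

theorem unifModerate_zpow (d : ℕ) :
    UnifModerate fun (ε : Eps) (_ : E) => ((((ε : ℝ) ^ (-(d : ℤ)) : ℝ)) : ℂ) := by
  refine ⟨fun ε => contDiff_const, fun i => ⟨d, 1, zero_le_one, fun ε x => ?_⟩⟩
  rw [one_mul]
  rcases Nat.eq_zero_or_pos i with rfl | hi
  · rw [norm_iteratedFDeriv_zero, Complex.norm_real, Real.norm_eq_abs,
      abs_of_pos (zpow_pos ε.pos _)]
  · rw [iteratedFDeriv_const_of_ne hi.ne']
    simpa using (pow_pos ε.pos d).le

theorem Eps.abs_inv (ε : Eps) : |(ε : ℝ)⁻¹| = (ε : ℝ)⁻¹ := abs_of_pos (inv_pos.2 ε.pos)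

theorem unifModerate_Theta (ρ : 𝓢(E, ℂ)) {χ : E → ℝ} (hχ : BddDerivs fun x => (χ x : ℂ)) :
    UnifModerate (Theta ρ χ) :=
  ((unifModerate_zpow _).mul (unifModerate_dilation (bddDerivs_schwartz ρ)
    (a := fun ε => (ε : ℝ)⁻¹) fun ε => ε.abs_inv.le)).mul (unifModerate_dilation hχ
    (a := fun ε => |Real.log ε|) fun ε => by rw [abs_abs]; exact ε.abs_log_le)

/-- The second factor vanishes unless `|ln ε| ‖x‖ ≥ r`. There `‖x / ε‖ ≥ r / (ε |ln ε|)`, which is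
at least of order `ε ^ (-1/2)`, so rapid decay of `ρ` and of its derivatives wins over every power
of `ε`. -/
theorem unifNegligible_schwartz_mul (ρ : 𝓢(E, ℂ)) {χ : E → ℂ} (hχ : BddDerivs χ)
    (h0 : ∀ᶠ x in nhds (0 : E), χ x = 0) :
    UnifNegligible fun (ε : Eps) x => ρ ((ε : ℝ)⁻¹ • x) * χ (|Real.log ε| • x) := by
  have hρ := bddDerivs_schwartz ρ
  have hs1 : ∀ ε : Eps, ContDiff ℝ ∞ fun x => ρ ((ε : ℝ)⁻¹ • x) := fun ε =>
    hρ.1.comp (contDiff_const_smul _)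
  have hs2 : ∀ ε : Eps, ContDiff ℝ ∞ fun x => χ (|Real.log ε| • x) := fun ε =>
    hχ.1.comp (contDiff_const_smul _)
  refine ⟨fun ε => (hs1 ε).mul (hs2 ε), fun i N => ?_⟩
  obtain ⟨r, hr, hball⟩ := Metric.eventually_nhds_iff_ball.1 h0
  -- Decay of order `2 * k` yields `ε ^ k`; `i` of these powers pay for the factors `ε⁻¹` and `|ln
  -- ε| ≤ ε⁻¹` produced by `i` derivatives, and `N` remain.
  set k := N + i with hk
  have hdec : ∀ j, ∃ C : ℝ, 0 ≤ C ∧ ∀ y, ‖y‖ ^ (2 * k) * ‖iteratedFDeriv ℝ j ρ y‖ ≤ C := fun j =>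
    let ⟨C, hC⟩ := ρ.decay (2 * k) j
    ⟨C, hC.1.le, hC.2⟩
  choose C hC0 hC using hdec
  choose D hD0 hD using hχ.2
  refine ⟨∑ j ∈ Finset.range (i + 1), (i.choose j : ℝ) * (C j * (4 / r ^ 2) ^ k * D (i - j)),
    Finset.sum_nonneg fun j _ => by have := hC0 j; have := hD0 (i - j); positivity,
    fun ε x => ?_⟩
  refine (norm_iteratedFDeriv_mul_le (N := ∞) (hs1 ε) (hs2 ε) x (n := i)
    (by exact_mod_cast le_top)).trans ?_
  rw [Finset.sum_mul]
  refine Finset.sum_le_sum fun j hj => ?_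
  have hj' : j ≤ i := Nat.lt_succ_iff.1 (Finset.mem_range.1 hj)
  rw [mul_assoc, mul_assoc]
  refine mul_le_mul_of_nonneg_left ?_ (Nat.cast_nonneg _)
  have hε := ε.pos
  have hCj := hC0 j
  have hDj := hD0 (i - j)
  -- The inequality is open in `x`, so in the first case all derivatives of the dilated `χ` vanish.
  by_cases hx : |Real.log ε| * ‖x‖ < r
  · have hz : (fun x => χ (|Real.log ε| • x)) =ᶠ[nhds x] fun _ => 0 := by
      have ho : IsOpen {x : E | |Real.log ε| * ‖x‖ < r} :=
        isOpen_lt (by fun_prop) continuous_const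
      filter_upwards [ho.mem_nhds hx] with y hy
      refine hball _ ?_
      rw [mem_ball_zero_iff, norm_smul, Real.norm_eq_abs, abs_abs]
      exact hy
    rw [(hz.iteratedFDeriv ℝ (i - j)).eq_of_nhds, iteratedFDeriv_fun_zero]
    simp only [Pi.zero_apply, norm_zero, mul_zero]
    positivity
  · rw [not_lt] at hx
    rw [norm_iteratedFDeriv_dilation hρ.1, norm_iteratedFDeriv_dilation hχ.1, abs_abs, ε.abs_inv]
    set y := (ε : ℝ)⁻¹ • x with hy
    have hlog : 0 < |Real.log ε| := by
      rcases (abs_nonneg (Real.log ε)).eq_or_lt with h | h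
      · rw [← h, zero_mul] at hx; exact absurd hx (not_le.2 hr)
      · exact h
    have hyn : r ≤ ‖y‖ * (ε * |Real.log ε|) := by
      rw [hy, norm_smul, norm_inv, Real.norm_eq_abs, abs_of_pos hε]
      calc r ≤ |Real.log ε| * ‖x‖ := hx
        _ = (ε : ℝ)⁻¹ * ‖x‖ * (ε * |Real.log ε|) := by field_simp
    have hpow : r ^ (2 * k) ≤ ‖y‖ ^ (2 * k) * (4 * ε) ^ k := by
      calc r ^ (2 * k) ≤ (‖y‖ * (ε * |Real.log ε|)) ^ (2 * k) := by gcongr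
        _ = ‖y‖ ^ (2 * k) * ((ε * |Real.log ε|) ^ 2) ^ k := by rw [mul_pow, pow_mul (_ * _)]
        _ ≤ ‖y‖ ^ (2 * k) * (4 * ε) ^ k := by
          gcongr
          exact ε.mul_abs_log_sq_le
    have h1 : ‖iteratedFDeriv ℝ j ρ y‖ ≤ C j * (4 / r ^ 2) ^ k * (ε : ℝ) ^ k := by
      have h2 : r ^ (2 * k) * ‖iteratedFDeriv ℝ j ρ y‖ ≤ C j * (4 * ε) ^ k := by
        calc r ^ (2 * k) * ‖iteratedFDeriv ℝ j ρ y‖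
            ≤ ‖y‖ ^ (2 * k) * (4 * ε) ^ k * ‖iteratedFDeriv ℝ j ρ y‖ := by gcongr
          _ = ‖y‖ ^ (2 * k) * ‖iteratedFDeriv ℝ j ρ y‖ * (4 * ε) ^ k := by ring
          _ ≤ C j * (4 * ε) ^ k := by gcongr; exact hC j y
      have h3 : C j * (4 / r ^ 2) ^ k * (ε : ℝ) ^ k = C j * (4 * ε) ^ k / r ^ (2 * k) := by
        rw [div_pow, ← pow_mul, mul_pow]; ring
      rw [h3, le_div_iff₀ (by positivity), mul_comm]
      exact h2
    have h4 : |Real.log ε| ^ (i - j) ≤ (ε : ℝ)⁻¹ ^ (i - j) :=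
      pow_le_pow_left₀ (abs_nonneg _) ε.abs_log_le _
    calc ((ε : ℝ)⁻¹ ^ j * ‖iteratedFDeriv ℝ j ρ y‖)
          * (|Real.log ε| ^ (i - j) * ‖iteratedFDeriv ℝ (i - j) χ (|Real.log ε| • x)‖)
        ≤ ((ε : ℝ)⁻¹ ^ j * (C j * (4 / r ^ 2) ^ k * (ε : ℝ) ^ k))
          * ((ε : ℝ)⁻¹ ^ (i - j) * D (i - j)) := by
          gcongr
          exact hD _ _
      _ = C j * (4 / r ^ 2) ^ k * D (i - j) * ((ε : ℝ)⁻¹ ^ j * (ε : ℝ)⁻¹ ^ (i - j) * (ε : ℝ) ^ k) := by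
          ring
      _ = C j * (4 / r ^ 2) ^ k * D (i - j) * (ε : ℝ) ^ (N : ℤ) := by
          rw [← pow_add, Nat.add_sub_cancel' hj', hk, pow_add, zpow_natCast]
          congr 1
          rw [inv_pow]
          field_simp
          ring
      _ = _ := by ring

theorem unifNegligible_Theta (ρ : 𝓢(E, ℂ)) {χ : E → ℝ} (hχ : BddDerivs fun x => (χ x : ℂ))
    (h0 : ∀ᶠ x in nhds (0 : E), χ x = 0) : UnifNegligible (Theta ρ χ) := by
  have h := (unifModerate_zpow (E := E) (Module.finrank ℝ E)).mul_negligible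
    (unifNegligible_schwartz_mul ρ hχ (h0.mono fun x hx => by simp [hx]))
  convert h using 3
  exact mul_assoc _ _ _

end UniformNets

/-! ### Moderateness of regularised distributions -/

section Regularization

variable {E G : Type} [NormedAddCommGroup E] [NormedSpace ℝ E]
  [NormedAddCommGroup G] [NormedSpace ℝ G]

theorem contDiff_jetForm {M : Compacts G} {k : ℕ} (S : C(M, Jet G k) →L[ℂ] ℂ)
    {Φ : E × G → ℂ} (hΦ : ContDiff ℝ ∞ Φ) :
    ContDiff ℝ ∞ fun x => S (jetOn M k fun z => Φ (x, z)) :=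
  (S.restrictScalars ℝ).contDiff.comp (contDiff_jetOn M k hΦ)

/-- A form in jets of order `k` costs at most `k` derivatives in `z`, added to the `j` derivatives
in the parameter; the power of `ε` is unchanged. -/
theorem UnifBigO.jetForm {M : Compacts G} {k : ℕ} (S : C(M, Jet G k) →L[ℂ] ℂ)
    {u : Net (E × G)} (hu : ∀ ε, ContDiff ℝ ∞ (u ε)) {j : ℕ} {e : ℤ}
    (h : ∀ i ≤ k, UnifBigO (i + j) u e) :
    UnifBigO j (fun ε x => S (jetOn M k fun z => u ε (x, z))) e := by
  choose! C hC0 hC using h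
  have hsum : ∀ i ≤ k, C i ≤ ∑ i ∈ Finset.range (k + 1), C i := fun i hi =>
    Finset.single_le_sum (f := C)
      (fun i hi => hC0 i (Nat.lt_succ_iff.1 (Finset.mem_range.1 hi)))
      (Finset.mem_range.2 (Nat.lt_succ_of_le hi))
  have hnn : 0 ≤ ∑ i ∈ Finset.range (k + 1), C i :=
    Finset.sum_nonneg fun i hi => hC0 i (Nat.lt_succ_iff.1 (Finset.mem_range.1 hi))
  refine ⟨‖S.restrictScalars ℝ‖ * ∑ i ∈ Finset.range (k + 1), C i, by positivity, fun ε x => ?_⟩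
  have hε := zpow_pos ε.pos e
  have h1 := (S.restrictScalars ℝ).iteratedFDeriv_comp_left
    (contDiff_jetOn M k (hu ε)).contDiffAt (x := x) (i := j) (by exact_mod_cast le_top)
  have h2 : iteratedFDeriv ℝ j (fun x => S (jetOn M k fun z => u ε (x, z))) x = _ := h1
  rw [h2]
  refine (ContinuousLinearMap.norm_compContinuousMultilinearMap_le _ _).trans ?_
  rw [mul_assoc]
  refine mul_le_mul_of_nonneg_left ?_ (norm_nonneg _)
  refine norm_iteratedFDeriv_jetOn_le M k j (hu ε) x (by positivity) fun z _ i hi => ?_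
  exact (hC i hi ε _).trans (mul_le_mul_of_nonneg_right (hsum i hi) hε.le)

theorem UnifModerate.jetForm {M : Compacts G} {k : ℕ} (S : C(M, Jet G k) →L[ℂ] ℂ)
    {u : Net (E × G)} (hu : UnifModerate u) :
    UnifModerate fun ε x => S (jetOn M k fun z => u ε (x, z)) := by
  refine ⟨fun ε => contDiff_jetForm S (hu.1 ε), fun j => ?_⟩
  obtain ⟨N, hN⟩ := hu.exists_common (k + j)
  exact ⟨N, UnifBigO.jetForm S hu.1 fun i hi => hN _ (by omega)⟩

theorem UnifNegligible.jetForm {M : Compacts G} {k : ℕ} (S : C(M, Jet G k) →L[ℂ] ℂ)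
    {u : Net (E × G)} (hu : UnifNegligible u) :
    UnifNegligible fun ε x => S (jetOn M k fun z => u ε (x, z)) :=
  ⟨fun ε => contDiff_jetForm S (hu.1 ε),
    fun j N => UnifBigO.jetForm S hu.1 fun i _ => hu.2 (i + j) N⟩

/-- A net that agrees for small `ε` with a uniformly controlled one near a compact set. -/
theorem UnifBigO.seminormBigO {u v : Net E} {l : ℕ} {e : ℤ} (hv : ∀ i ≤ l, UnifBigO i v e)
    {K U : Set E} (hU : IsOpen U) (hKU : K ⊆ U) {η : ℝ} (hη : 0 < η)
    (huv : ∀ ε : Eps, (ε : ℝ) < η → ∀ x ∈ U, u ε x = v ε x) : SeminormBigO K l u e := by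
  choose! C hC0 hC using hv
  refine ⟨∑ i ∈ Finset.range (l + 1), C i, η, hη, fun ε hε x hx i hi => ?_⟩
  have h : u ε =ᶠ[nhds x] v ε := by
    filter_upwards [hU.mem_nhds (hKU hx)] with y hy using huv ε hε y hy
  rw [(h.iteratedFDeriv ℝ i).eq_of_nhds]
  refine (hC i hi ε x).trans (mul_le_mul_of_nonneg_right ?_ (zpow_pos ε.pos e).le)
  exact Finset.single_le_sum (f := C)
    (fun i hi => hC0 i (Nat.lt_succ_iff.1 (Finset.mem_range.1 hi)))
    (Finset.mem_range.2 (Nat.lt_succ_of_le hi))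

theorem exists_Theta_support (ρ : 𝓢(G, ℂ)) {χ : G → ℝ} (hχ : HasCompactSupport χ) {δ : ℝ}
    (hδ : 0 < δ) : ∃ η : ℝ, 0 < η ∧ ∀ ε : Eps, (ε : ℝ) < η → ∀ z, Theta ρ χ ε z ≠ 0 → ‖z‖ ≤ δ := by
  obtain ⟨R, hR⟩ := hχ.isCompact.isBounded.exists_norm_le
  have hR' : R ≤ |R| := le_abs_self R
  -- The support of `Θ_ε` lies in the ball of radius `R / |ln ε|`, and this `η` gives `|ln ε| > |R|
  -- / δ`.
  refine ⟨Real.exp (-(|R| / δ)), Real.exp_pos _, fun ε hε z hz => ?_⟩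
  have h1 : χ (|Real.log ε| • z) ≠ 0 := fun h0 => hz (by simp [Theta, h0])
  have h2 := hR _ (subset_tsupport _ h1)
  rw [norm_smul, Real.norm_eq_abs, abs_abs] at h2
  have h3 : Real.log ε < -(|R| / δ) := (Real.log_lt_iff_lt_exp ε.pos).2 hε
  have h4 : |R| / δ < |Real.log ε| := by
    rw [abs_of_nonpos (Real.log_nonpos ε.pos.le ε.le_one)]
    linarith
  by_contra hzδ
  rw [not_le] at hzδ
  have h5 : |R| < |Real.log ε| * ‖z‖ := by
    calc |R| = |R| / δ * δ := by field_simp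
      _ < |Real.log ε| * ‖z‖ := mul_lt_mul h4 hzδ.le hδ (abs_nonneg _)
  linarith

theorem bddDerivs_ofReal_testFunction {Ω : Opens G} (χ : 𝓓(Ω, ℝ)) :
    BddDerivs fun x => ((χ x : ℝ) : ℂ) :=
  BddDerivs.of_hasCompactSupport (Complex.ofRealCLM.contDiff.comp χ.contDiff)
    (χ.hasCompactSupport.comp_left (g := ((↑) : ℝ → ℂ)) Complex.ofReal_zero)

theorem kernelTest_apply {Ω : Opens G} (ρ : 𝓢(G, ℂ)) (c : Cutoff Ω) (ε : Eps) (x ξ : G) :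
    kernelTest ρ c ε x ξ = (c.γ ε ξ : ℂ) * Theta ρ c.χ ε (x - ξ) := rfl

/-- Near a compact set and for small `ε`, the cut-off `γ` disappears from the regularisation. -/
theorem exists_kernelTest_eq [ProperSpace G] {Ω : Opens G} (ρ : 𝓢(G, ℂ)) (c : Cutoff Ω)
    {L : Set G} (hL : IsCompact L) (hLΩ : L ⊆ Ω) :
    ∃ M : Compacts G, (M : Set G) ⊆ Ω ∧ ∃ η : ℝ, 0 < η ∧ ∀ ε : Eps, (ε : ℝ) < η → ∀ x ∈ L,
      (kernelTest ρ c ε x : G → ℂ) = (fun ξ => Theta ρ c.χ ε (x - ξ)) ∧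
      tsupport (kernelTest ρ c ε x) ⊆ M := by
  -- The set `M` is the closed `δ`-thickening of `L`: for small `ε` it contains every `ξ` with
  -- `Θ_ε(x - ξ) ≠ 0`, and `γ_ε = 1` on it.
  obtain ⟨δ, hδ, hδΩ⟩ := hL.exists_cthickening_subset_open Ω.isOpen hLΩ
  have hM := hL.cthickening (r := δ)
  obtain ⟨η₁, hη₁, h₁⟩ := exists_Theta_support ρ c.χ.hasCompactSupport hδ
  obtain ⟨η₂, hη₂, h₂⟩ := c.γ_eq_one _ hM hδΩ
  refine ⟨⟨_, hM⟩, hδΩ, min η₁ η₂, lt_min hη₁ hη₂, fun ε hε x hx => ?_⟩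
  have hmem : ∀ ξ, Theta ρ c.χ ε (x - ξ) ≠ 0 → ξ ∈ Metric.cthickening δ L := fun ξ hξ => by
    refine Metric.mem_cthickening_of_dist_le ξ x δ L hx ?_
    rw [dist_comm, dist_eq_norm]
    exact h₁ ε (hε.trans_le (min_le_left _ _)) _ hξ
  refine ⟨funext fun ξ => ?_, closure_minimal (fun ξ hξ => ?_) hM.isClosed⟩
  · rw [kernelTest_apply]
    by_cases h0 : Theta ρ c.χ ε (x - ξ) = 0
    · rw [h0, mul_zero]
    · rw [h₂ ε (hε.trans_le (min_le_right _ _)) ξ (hmem ξ h0), Complex.ofReal_one, one_mul]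
  · refine hmem ξ fun h0 => hξ ?_
    rw [kernelTest_apply, h0, mul_zero]

/-- For fixed `ε` all the test functions are supported in the compact support of `γ_ε`, whatever `x`
is, so a single linear form in jets serves. No smallness of `ε` is needed here. -/
theorem contDiff_regularize {Ω : Opens G} (ρ : 𝓢(G, ℂ)) (c : Cutoff Ω) (T : Distrib Ω) (ε : Eps) :
    ContDiff ℝ ∞ (regularize ρ c T ε) := by
  set M : Compacts G := ⟨tsupport (c.γ ε), (c.γ ε).hasCompactSupport⟩ with hM
  obtain ⟨k, S, hS⟩ := exists_jet_extension T M (c.γ ε).tsupport_subset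
  have h1 : ContDiff ℝ ∞ fun p : G × G => (c.γ ε p.2 : ℂ) * Theta ρ c.χ ε (p.1 - p.2) :=
    (Complex.ofRealCLM.contDiff.comp ((c.γ ε).contDiff.comp contDiff_snd)).mul
      ((contDiff_Theta ρ c.χ.contDiff ε).comp (contDiff_fst.sub contDiff_snd))
  have h2 : regularize ρ c T ε = fun x => S (jetOn M k fun ξ => (c.γ ε ξ : ℂ) *
      Theta ρ c.χ ε (x - ξ)) := funext fun x => ?_
  · rw [h2]
    exact contDiff_jetForm S h1
  refine hS (kernelTest ρ c ε x) (closure_minimal (fun ξ hξ => ?_) (isClosed_tsupport _))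
  refine subset_tsupport _ fun h0 => hξ ?_
  rw [kernelTest_apply, h0, Complex.ofReal_zero, zero_mul]

theorem isModerate_regularize [ProperSpace G] {Ω : Opens G} (ρ : 𝓢(G, ℂ)) (c : Cutoff Ω)
    (T : Distrib Ω) : IsModerate Ω (regularize ρ c T) := by
  refine ⟨fun ε => (contDiff_regularize ρ c T ε).contDiffOn, fun K hK hKΩ l => ?_⟩
  -- A neighbourhood of `K` is needed: to compare derivatives on `K`, the net must agree with the
  -- form in jets on an open set. The compact `M` and the form `S` do not depend on `ε`.
  obtain ⟨L, hL, hKL, hLΩ⟩ := exists_compact_between hK Ω.isOpen hKΩ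
  obtain ⟨M, hM, η, hη, hker⟩ := exists_kernelTest_eq ρ c hL hLΩ
  obtain ⟨k, S, hS⟩ := exists_jet_extension T M hM
  have hu : UnifModerate fun (ε : Eps) (p : G × G) => Theta ρ c.χ ε (p.1 - p.2) :=
    (unifModerate_Theta ρ (bddDerivs_ofReal_testFunction c.χ)).comp_clm
      (ContinuousLinearMap.fst ℝ G G - ContinuousLinearMap.snd ℝ G G)
  obtain ⟨N, hN⟩ := (hu.jetForm S).exists_common l
  refine ⟨N, UnifBigO.seminormBigO hN isOpen_interior hKL hη fun ε hε x hx => ?_⟩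
  obtain ⟨h1, h2⟩ := hker ε hε x (interior_subset hx)
  rw [← h1]
  exact hS _ h2

end Regularization

/-! ### Calculus of the seminorm estimates, and classes of nets -/

section Seminorms

variable {E F : Type} [NormedAddCommGroup E] [NormedSpace ℝ E]
  [NormedAddCommGroup F] [NormedSpace ℝ F]

theorem SeminormBigO.exists_nonneg {K : Set E} {l : ℕ} {u : Net E} {e : ℤ}
    (h : SeminormBigO K l u e) : ∃ C : ℝ, 0 ≤ C ∧ ∃ η : ℝ, 0 < η ∧ ∀ ε : Eps, (ε : ℝ) < η →
      ∀ x ∈ K, ∀ i ≤ l, ‖iteratedFDeriv ℝ i (u ε) x‖ ≤ C * (ε : ℝ) ^ e := by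
  obtain ⟨C, η, hη, H⟩ := h
  exact ⟨|C|, abs_nonneg C, η, hη, fun ε hε x hx i hi => (H ε hε x hx i hi).trans
    (mul_le_mul_of_nonneg_right (le_abs_self C) (zpow_pos ε.pos e).le)⟩

theorem SeminormBigO.mul {Ω : Opens E} {K : Set E} (hK : K ⊆ Ω) {l : ℕ} {u v : Net E} {a b : ℤ}
    (hu' : ∀ ε, ContDiffOn ℝ ∞ (u ε) Ω) (hv' : ∀ ε, ContDiffOn ℝ ∞ (v ε) Ω)
    (hu : SeminormBigO K l u a) (hv : SeminormBigO K l v b) :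
    SeminormBigO K l (fun ε x => u ε x * v ε x) (a + b) := by
  obtain ⟨C, hC0, η, hη, H⟩ := hu.exists_nonneg
  obtain ⟨D, hD0, η', hη', H'⟩ := hv.exists_nonneg
  refine ⟨2 ^ l * (C * D), min η η', lt_min hη hη', fun ε hε x hx i hi => ?_⟩
  have hxΩ := hK hx
  have h1 := norm_iteratedFDerivWithin_mul_le (𝕜 := ℝ) (hu' ε) (hv' ε) Ω.isOpen.uniqueDiffOn hxΩ
    (n := i) (by exact_mod_cast le_top)
  simp only [iteratedFDerivWithin_of_isOpen _ Ω.isOpen hxΩ] at h1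
  refine h1.trans ?_
  have hεa := zpow_pos ε.pos a
  have hεb := zpow_pos ε.pos b
  calc ∑ j ∈ Finset.range (i + 1), (i.choose j : ℝ) * ‖iteratedFDeriv ℝ j (u ε) x‖
        * ‖iteratedFDeriv ℝ (i - j) (v ε) x‖
      ≤ ∑ j ∈ Finset.range (i + 1), (i.choose j : ℝ) * (C * (ε : ℝ) ^ a) * (D * (ε : ℝ) ^ b) := by
        refine Finset.sum_le_sum fun j hj => ?_
        have hj' : j ≤ i := Nat.lt_succ_iff.1 (Finset.mem_range.1 hj)
        gcongr
        · exact H ε (hε.trans_le (min_le_left _ _)) x hx j (hj'.trans hi)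
        · exact H' ε (hε.trans_le (min_le_right _ _)) x hx _ ((Nat.sub_le _ _).trans hi)
    _ = 2 ^ i * (C * (ε : ℝ) ^ a) * (D * (ε : ℝ) ^ b) := by
        rw [← Finset.sum_mul, ← Finset.sum_mul]
        congr 2
        exact_mod_cast Nat.sum_range_choose i
    _ ≤ 2 ^ l * (C * (ε : ℝ) ^ a) * (D * (ε : ℝ) ^ b) := by
        gcongr
        norm_num
    _ = 2 ^ l * (C * D) * (ε : ℝ) ^ (a + b) := by
        rw [zpow_add₀ ε.pos.ne']; ring

theorem SeminormBigO.comp_snd {Y : Opens F} {K : Set E} {L : Set F} (hL : L ⊆ Y) {l : ℕ}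
    {v : Net F} {e : ℤ} (hv' : ∀ ε, ContDiffOn ℝ ∞ (v ε) Y) (hv : SeminormBigO L l v e) :
    SeminormBigO (K ×ˢ L) l (fun ε (p : E × F) => v ε p.2) e := by
  obtain ⟨C, η, hη, H⟩ := hv
  refine ⟨C, η, hη, fun ε hε p hp i hi => le_trans ?_ (H ε hε p.2 hp.2 i hi)⟩
  have h := norm_iteratedFDeriv_comp_affine_le Y.isOpen (hv' ε) (ContinuousLinearMap.snd ℝ E F) 0
    (x := p) (by simpa using hL hp.2) i
  simp only [add_zero, ContinuousLinearMap.coe_snd'] at h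
  exact h.trans (mul_le_of_le_one_right (norm_nonneg _)
    (pow_le_one₀ (norm_nonneg _) (ContinuousLinearMap.norm_snd_le ℝ E F)))

theorem SeminormBigO.congr {Ω : Opens E} {K : Set E} (hK : K ⊆ Ω) {l : ℕ} {u v : Net E} {e : ℤ}
    (huv : ∀ ε, EqOn (u ε) (v ε) Ω) (hu : SeminormBigO K l u e) : SeminormBigO K l v e := by
  obtain ⟨C, η, hη, H⟩ := hu
  refine ⟨C, η, hη, fun ε hε x hx i hi => ?_⟩
  have h : v ε =ᶠ[nhds x] u ε := by
    filter_upwards [Ω.isOpen.mem_nhds (hK hx)] with y hy using (huv ε hy).symm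
  rw [(h.iteratedFDeriv ℝ i).eq_of_nhds]
  exact H ε hε x hx i hi

theorem IsNegligible.congr {Ω : Opens E} {u v : Net E} (huv : ∀ ε, EqOn (u ε) (v ε) Ω)
    (hu : IsNegligible Ω u) : IsNegligible Ω v :=
  ⟨fun ε => (hu.1 ε).congr (huv ε).symm,
    fun K hK hKΩ l N => (hu.2 K hK hKΩ l N).congr hKΩ huv⟩

theorem represents_rep {Ω : Opens E} (g : GenFun Ω) : Represents Ω (rep g) g :=
  ⟨(Quotient.out g : moderate Ω).2, Quotient.out_eq g⟩

theorem Represents.sub_negligible {Ω : Opens E} {u v : Net E} {g : GenFun Ω}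
    (hu : Represents Ω u g) (hv : Represents Ω v g) : IsNegligible Ω (u - v) := by
  obtain ⟨hu, rfl⟩ := hu
  obtain ⟨hv, h⟩ := hv
  exact (Submodule.Quotient.eq _).1 h.symm

theorem cl_eq {Ω : Opens E} {u v : Net E} (hu : IsModerate Ω u) (hv : IsModerate Ω v)
    (h : IsNegligible Ω (u - v)) : cl Ω u = cl Ω v := by
  rw [cl, cl, dif_pos (show u ∈ moderate Ω from hu), dif_pos (show v ∈ moderate Ω from hv)]
  exact (Submodule.Quotient.eq _).2 h

theorem represents_cl {Ω : Opens E} {u : Net E} (hu : IsModerate Ω u) :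
    Represents Ω u (cl Ω u) :=
  ⟨hu, by rw [cl, dif_pos (show u ∈ moderate Ω from hu)]⟩

/-- Every point of `L` has an open neighbourhood on which the class restricts to zero, hence a
compact one on which `v` is negligible. Finitely many of these cover `L`. -/
theorem Represents.seminormBigO_of_disjoint_supp [LocallyCompactSpace E] {Ω : Opens E} {v : Net E}
    {g : GenFun Ω} (hv : Represents Ω v g) {L : Set E} (hL : IsCompact L) (hLΩ : L ⊆ Ω)
    (hd : Disjoint L (supp g)) (l N : ℕ) : SeminormBigO L l v (N : ℤ) := by
  obtain ⟨hv, rfl⟩ := hv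
  refine hL.induction_on (p := fun s => SeminormBigO s l v (N : ℤ)) ?_ ?_ ?_ fun x hx => ?_
  · exact ⟨0, 1, one_pos, fun _ _ _ h => h.elim⟩
  · rintro s t hst ⟨C, η, hη, H⟩
    exact ⟨C, η, hη, fun ε hε x hx => H ε hε x (hst hx)⟩
  · intro s t hs ht
    obtain ⟨C, hC0, η, hη, H⟩ := hs.exists_nonneg
    obtain ⟨D, hD0, η', hη', H'⟩ := ht.exists_nonneg
    refine ⟨C + D, min η η', lt_min hη hη', fun ε hε x hx i hi => ?_⟩
    have hεN := zpow_pos ε.pos (N : ℤ)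
    rcases hx with hx | hx
    · exact (H ε (hε.trans_le (min_le_left _ _)) x hx i hi).trans (by gcongr; linarith)
    · exact (H' ε (hε.trans_le (min_le_right _ _)) x hx i hi).trans (by gcongr; linarith)
  · have hxs : x ∈ ⋃ (V : Opens E) (h : V ≤ Ω)
        (_ : restrict h (Submodule.Quotient.mk ⟨v, hv⟩ : GenFun Ω) = 0), (V : Set E) := by
      by_contra hne
      exact Set.disjoint_left.1 hd hx ⟨hLΩ hx, hne⟩
    simp only [mem_iUnion] at hxs
    obtain ⟨V, hVΩ, h0, hxV⟩ := hxs
    rw [restrict, Submodule.mapQ_apply, Submodule.Quotient.mk_eq_zero] at h0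
    have hneg : IsNegligible V v := h0
    obtain ⟨t, ht, htV, htc⟩ := local_compact_nhds (V.isOpen.mem_nhds hxV)
    exact ⟨t, mem_nhdsWithin_of_mem_nhds ht, hneg.2 t htc htV l N⟩

end Seminorms

/-! ### Estimates for integral operators acting on nets -/

section IntegralOperators

variable {E F : Type} [NormedAddCommGroup E] [NormedSpace ℝ E]
  [NormedAddCommGroup F] [NormedSpace ℝ F] [MeasurableSpace F] [BorelSpace F]
  {X : Opens E} {Y : Opens F}

theorem contDiffOn_mul_snd {u : E × F → ℂ} {v : F → ℂ}
    (hu : ContDiffOn ℝ ∞ u (prodOpens X Y)) (hv : ContDiffOn ℝ ∞ v Y) :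
    ContDiffOn ℝ ∞ (fun p : E × F => u p * v p.2) ((X : Set E) ×ˢ (Y : Set F)) :=
  hu.mul (hv.comp contDiff_snd.contDiffOn fun _ hp => hp.2)

theorem SeminormBigO.integral (μ : Measure F) [IsFiniteMeasureOnCompacts μ] {K : Set E}
    (hK : K ⊆ X) (L : Compacts F) (hL : (L : Set F) ⊆ Y) {u : Net (E × F)} {v : Net F} {l : ℕ}
    {a b : ℤ} (hu' : ∀ ε, ContDiffOn ℝ ∞ (u ε) (prodOpens X Y)) (hv' : ∀ ε, ContDiffOn ℝ ∞ (v ε) Y)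
    (hu : SeminormBigO (K ×ˢ (L : Set F)) l u a) (hv : SeminormBigO (L : Set F) l v b) :
    SeminormBigO K l (fun ε x => ∫ y in L, u ε (x, y) * v ε y ∂μ) (a + b) := by
  have h1 : SeminormBigO (K ×ˢ (L : Set F)) l (fun ε p => u ε p * v ε p.2) (a + b) :=
    SeminormBigO.mul (Ω := prodOpens X Y) (Set.prod_mono hK hL) hu'
      (fun ε => (hv' ε).comp contDiff_snd.contDiffOn fun _ hp => hp.2) hu (hv.comp_snd hL hv')
  obtain ⟨C, hC0, η, hη, H⟩ := h1.exists_nonneg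
  refine ⟨μ.real L * C, η, hη, fun ε hε x hx i hi => ?_⟩
  have hε := zpow_pos ε.pos (a + b)
  rw [mul_assoc]
  exact norm_iteratedFDeriv_integral_le μ L X.isOpen Y.isOpen hL
    (contDiffOn_mul_snd (hu' ε) (hv' ε)) (hK hx) i (by positivity)
    fun y hy => H ε (by assumption) (x, y) ⟨hx, hy⟩ i hi

/-- The decay of `v` is required on `L` only, and `μ` is arbitrary, so that
`isNegligible_integral_diff` can use a `v` that is small merely off its support, with a restricted
measure. -/
theorem isNegligible_integral (μ : Measure F) [IsFiniteMeasureOnCompacts μ]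
    (L : Compacts F) (hL : (L : Set F) ⊆ Y) {u : Net (E × F)} {v : Net F}
    (hu : IsModerate (prodOpens X Y) u) (hv' : ∀ ε, ContDiffOn ℝ ∞ (v ε) Y)
    (hv : ∀ l N : ℕ, SeminormBigO (L : Set F) l v (N : ℤ)) :
    IsNegligible X (fun ε x => ∫ y in L, u ε (x, y) * v ε y ∂μ) := by
  refine ⟨fun ε => contDiffOn_integral μ L X.isOpen Y.isOpen hL
    (contDiffOn_mul_snd (hu.1 ε) (hv' ε)), fun K hK hKX l N => ?_⟩
  obtain ⟨M, hM⟩ := hu.2 _ (hK.prod L.isCompact) (Set.prod_mono hKX hL) l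
  refine (SeminormBigO.integral μ hKX L hL hu.1 hv' hM (hv l (M + N))).mono ?_
  push_cast
  omega

theorem isNegligible_integral_of_kernel (μ : Measure F) [IsFiniteMeasureOnCompacts μ]
    (L : Compacts F) (hL : (L : Set F) ⊆ Y) {u : Net (E × F)} {v : Net F}
    (hu : IsNegligible (prodOpens X Y) u) (hv : IsModerate Y v) :
    IsNegligible X (fun ε x => ∫ y in L, u ε (x, y) * v ε y ∂μ) := by
  refine ⟨fun ε => contDiffOn_integral μ L X.isOpen Y.isOpen hL
    (contDiffOn_mul_snd (hu.1 ε) (hv.1 ε)), fun K hK hKX l N => ?_⟩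
  obtain ⟨M, hM⟩ := hv.2 _ L.isCompact hL l
  refine (SeminormBigO.integral μ hKX L hL hu.1 hv.1
    (hu.2 _ (hK.prod L.isCompact) (Set.prod_mono hKX hL) l (M + N)) hM).mono ?_
  push_cast
  omega

end IntegralOperators

/-! ### The generalized integral operator is well defined -/

section WellDefined

variable {E F : Type} [NormedAddCommGroup E] [NormedSpace ℝ E]
  [NormedAddCommGroup F] [NormedSpace ℝ F] [MeasureSpace F] [BorelSpace F]
  [IsFiniteMeasureOnCompacts (volume : Measure F)]
  {X : Opens E} {Y : Opens F}

theorem isModerate_integralNet {u : Net (E × F)} {v : Net F} (hu : IsModerate (prodOpens X Y) u)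
    (hv : IsModerate Y v) {K : Set F} (hK : IsCompact K) (hKY : K ⊆ Y) :
    IsModerate X (integralNet u v K) := by
  refine ⟨fun ε => contDiffOn_integral volume ⟨K, hK⟩ X.isOpen Y.isOpen hKY
    (contDiffOn_mul_snd (hu.1 ε) (hv.1 ε)), fun L hL hLX l => ?_⟩
  obtain ⟨N, hN⟩ := hu.2 _ (hL.prod hK) (Set.prod_mono hLX hKY) l
  obtain ⟨M, hM⟩ := hv.2 _ hK hKY l
  refine ⟨N + M, (SeminormBigO.integral volume hLX ⟨K, hK⟩ hKY hu.1 hv.1 hN hM).mono ?_⟩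
  push_cast
  omega

theorem integrableOn_integralNet {u : Net (E × F)} {v : Net F}
    (hu : ∀ ε, ContDiffOn ℝ ∞ (u ε) (prodOpens X Y)) (hv : ∀ ε, ContDiffOn ℝ ∞ (v ε) Y)
    {K : Set F} (hK : IsCompact K) (hKY : K ⊆ Y) (ε : Eps) {x : E} (hx : x ∈ X) :
    IntegrableOn (fun y => u ε (x, y) * v ε y) K :=
  (continuousOn_slice (M := ⟨K, hK⟩) hKY (contDiffOn_mul_snd (hu ε) (hv ε)).continuousOn
    hx).integrableOn_compact hK

/-- Bilinearity: `u v - u' v' = (u - u') v + u' (v - v')`, and each summand has one negligible and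
one moderate factor. -/
theorem isNegligible_integralNet_sub {u u' : Net (E × F)} {v v' : Net F}
    (hu : IsModerate (prodOpens X Y) u) (hu' : IsModerate (prodOpens X Y) u')
    (hv : IsModerate Y v) (hv' : IsModerate Y v')
    (huu : IsNegligible (prodOpens X Y) (u - u')) (hvv : IsNegligible Y (v - v'))
    {K : Set F} (hK : IsCompact K) (hKY : K ⊆ Y) :
    IsNegligible X (integralNet u v K - integralNet u' v' K) := by
  have h1 := isNegligible_integral_of_kernel volume ⟨K, hK⟩ hKY huu hv
  have h2 := isNegligible_integral volume ⟨K, hK⟩ hKY hu' hvv.1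
    fun l N => hvv.2 K hK hKY l N
  refine IsNegligible.congr (fun ε x hx => ?_) ((negligible X).add_mem h1 h2)
  have i1 := integrableOn_integralNet huu.1 hv.1 hK hKY ε hx
  have i2 := integrableOn_integralNet hu'.1 hvv.1 hK hKY ε hx
  have i3 := integrableOn_integralNet hu.1 hv.1 hK hKY ε hx
  have i4 := integrableOn_integralNet hu'.1 hv'.1 hK hKY ε hx
  change (∫ y in K, (u - u') ε (x, y) * v ε y) + (∫ y in K, u' ε (x, y) * (v - v') ε y)
    = (∫ y in K, u ε (x, y) * v ε y) - ∫ y in K, u' ε (x, y) * v' ε y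
  rw [← integral_add i1 i2, ← integral_sub i3 i4]
  congr 1
  ext y
  simp only [Pi.sub_apply]
  ring

/-- Part of the integral over `K` that lies outside of `K'`. -/
theorem isNegligible_integral_diff [LocallyCompactSpace F] {u : Net (E × F)} {v : Net F}
    {f : GenFun Y} (hu : IsModerate (prodOpens X Y) u) (hv : Represents Y v f)
    {K K' : Set F} (hK : IsCompact K) (hKY : K ⊆ Y)
    (hf : supp f ⊆ interior K') :
    IsNegligible X fun ε x => ∫ y in K \ K', u ε (x, y) * v ε y := by
  have hL : IsCompact (K \ interior K') := hK.diff isOpen_interior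
  have hLY : K \ interior K' ⊆ Y := sdiff_subset.trans hKY
  have hd : Disjoint (K \ interior K') (supp f) :=
    Set.disjoint_left.2 fun y hy hys => hy.2 (hf hys)
  -- The set `K \ K'` need not be compact. The integral is taken over the compact `K \ interior K'`
  -- instead, against the volume restricted to `K \ K'`.
  have h := isNegligible_integral (volume.restrict (K \ K')) ⟨_, hL⟩ hLY hu hv.1.1
    fun l N => hv.seminormBigO_of_disjoint_supp hL hLY hd l N
  have e : (volume.restrict (K \ K')).restrict (K \ interior K') = volume.restrict (K \ K') := by
    rw [Measure.restrict_restrict hL.isClosed.measurableSet, inter_eq_right.2]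
    exact sdiff_subset_sdiff_right interior_subset
  simp only [Compacts.coe_mk, e] at h
  exact h

/-- The contributions of `K ∩ K'` cancel, which leaves the integrals over the two set differences.
-/
theorem isNegligible_integralNet_sub_domain [LocallyCompactSpace F] {u : Net (E × F)} {v : Net F}
    {f : GenFun Y} (hu : IsModerate (prodOpens X Y) u) (hv : Represents Y v f)
    {K K' : Set F} (hK : IsCompact K) (hKY : K ⊆ Y) (hK' : IsCompact K') (hKY' : K' ⊆ Y)
    (hf : supp f ⊆ interior K) (hf' : supp f ⊆ interior K') :
    IsNegligible X (integralNet u v K - integralNet u v K') := by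
  have h1 := isNegligible_integral_diff hu hv hK hKY hf'
  have h2 := isNegligible_integral_diff hu hv hK' hKY' hf
  refine IsNegligible.congr (fun ε x hx => ?_) ((negligible X).sub_mem h1 h2)
  have i1 := integrableOn_integralNet hu.1 hv.1.1 hK hKY ε hx
  have i2 := integrableOn_integralNet hu.1 hv.1.1 hK' hKY' ε hx
  have e1 := integral_inter_add_sdiff hK'.isClosed.measurableSet i1
  have e2 := integral_inter_add_sdiff hK.isClosed.measurableSet i2
  rw [inter_comm] at e2
  change (∫ y in K \ K', u ε (x, y) * v ε y) - (∫ y in K' \ K, u ε (x, y) * v ε y)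
    = (∫ y in K, u ε (x, y) * v ε y) - ∫ y in K', u ε (x, y) * v ε y
  rw [← e1, ← e2]
  ring

theorem genIntOpWellDefined [LocallyCompactSpace F] (H : GenFun (prodOpens X Y)) (f : GenFunC Y) :
    GenIntOpWellDefined H f := by
  intro u v K hu hv hK hfK hKY
  obtain ⟨hN, hfN, hNY⟩ := (exists_compact_between f.2 Y.isOpen (supp_subset f.1)).choose_spec
  have hru := represents_rep H
  have hrv := represents_rep f.1
  have hm := isModerate_integralNet hu.1 hv.1 hK hKY
  have hm' := isModerate_integralNet hu.1 hv.1 hN hNY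
  have hm'' := isModerate_integralNet hru.1 hrv.1 hN hNY
  -- The representatives are changed first, over the chosen neighbourhood of the support; then the
  -- domain is changed, with `u` and `v` fixed.
  have e : genIntOp H f = cl X (integralNet u v K) := by
    refine (cl_eq hm'' hm' ?_).trans (cl_eq hm' hm ?_)
    · exact isNegligible_integralNet_sub hru.1 hu.1 hrv.1 hv.1 (hru.sub_negligible hu)
        (hrv.sub_negligible hv) hN hNY
    · exact isNegligible_integralNet_sub_domain hu.1 hv hN hNY hK hKY hfN hfK
  rw [e]
  exact represents_cl hm

end WellDefined

/-! ### Vanishing moments and the mollification error -/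

section Moments

variable {F : Type} [NormedAddCommGroup F] [NormedSpace ℝ F] [FiniteDimensional ℝ F]
  [MeasureSpace F] [BorelSpace F] [(volume : Measure F).IsAddHaarMeasure]

theorem BddDerivs.fderiv {W : Type} [NormedAddCommGroup W] [NormedSpace ℝ W] {f : F → W}
    (hf : BddDerivs f) : BddDerivs (fderiv ℝ f) := by
  refine ⟨hf.1.fderiv_right (m := ∞) (by exact_mod_cast le_top), fun i => ?_⟩
  obtain ⟨C, hC0, hC⟩ := hf.2 (i + 1)
  exact ⟨C, hC0, fun x => by rw [norm_iteratedFDeriv_fderiv]; exact hC x⟩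

variable {W : Type} [NormedAddCommGroup W] [NormedSpace ℝ W] [NormedSpace ℂ W]
  [IsScalarTower ℝ ℂ W] [CompleteSpace W]

theorem integrable_schwartz_smul_pow (ρ : 𝓢(F, ℂ)) (k : ℕ) {g : F → W} (hg : Continuous g) {C : ℝ}
    (hC : ∀ w, ‖g w‖ ≤ C * ‖w‖ ^ k) : Integrable fun w => ρ w • g w := by
  refine ((ρ.integrable_pow_mul volume k).const_mul C).mono'
    (ρ.continuous.smul hg).aestronglyMeasurable (Filter.Eventually.of_forall fun w => ?_)
  rw [norm_smul]
  calc ‖ρ w‖ * ‖g w‖ ≤ ‖ρ w‖ * (C * ‖w‖ ^ k) := by gcongr; exact hC w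
    _ = C * (‖w‖ ^ k * ‖ρ w‖) := by ring

/-- In a basis, `A (w, …, w)` is a combination of products of `k` coordinate forms of `w` with
constant vectors, and `ρ` kills each such product. -/
theorem integral_multilinear_eq_zero {ρ : 𝓢(F, ℂ)} (hρ : IsMollifier ρ) {k : ℕ} (hk : 1 ≤ k)
    (A : F [×k]→L[ℝ] W) : ∫ w, ρ w • A (fun _ => w) = 0 := by
  let b := Module.finBasis ℝ F
  let L : Fin (Module.finrank ℝ F) → F →L[ℝ] ℝ := fun i => LinearMap.toContinuousLinearMap (b.coord i)
  have hexp : ∀ w, A (fun _ => w)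
      = ∑ r : Fin k → Fin (Module.finrank ℝ F), (∏ j, L (r j) w) • A (fun j => b (r j)) := by
    intro w
    have h1 : (fun _ : Fin k => w) = fun _ => ∑ i, L i w • b i := by
      funext _; exact (b.sum_repr w).symm
    conv_lhs => rw [h1]
    have h2 := A.toMultilinearMap.map_sum (fun (_ : Fin k) i => L i w • b i)
    refine h2.trans (Finset.sum_congr rfl fun r _ => ?_)
    exact A.toMultilinearMap.map_smul_univ (fun j => L (r j) w) (fun j => b (r j))
  have hmon : ∀ (r : Fin k → Fin (Module.finrank ℝ F)) (c : W),
      Integrable (fun w => ρ w • ((∏ j, L (r j) w) • c)) ∧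
        ∫ w, ρ w • ((∏ j, L (r j) w) • c) = 0 := by
    intro r c
    refine ⟨integrable_schwartz_smul_pow ρ k (C := (∏ j, ‖L (r j)‖) * ‖c‖) (by fun_prop)
      fun w => ?_, ?_⟩
    · rw [norm_smul, norm_prod, mul_right_comm]
      refine mul_le_mul_of_nonneg_right ?_ (norm_nonneg _)
      calc ∏ j, ‖L (r j) w‖ ≤ ∏ j : Fin k, (‖L (r j)‖ * ‖w‖) :=
            Finset.prod_le_prod (fun _ _ => norm_nonneg _) fun j _ => (L (r j)).le_opNorm w
        _ = (∏ j, ‖L (r j)‖) * ‖w‖ ^ k := by rw [Finset.prod_mul_distrib]; simp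
    · have h1 : ∀ w, ρ w • ((∏ j, L (r j) w) • c)
          = (((∏ j, L (r j) w : ℝ) : ℂ) * ρ w) • c := fun w => by
        rw [← algebraMap_smul ℂ (∏ j, L (r j) w) c, smul_smul, mul_comm]
        rfl
      simp_rw [h1]
      rw [integral_smul_const, hρ.moment_eq_zero k hk, zero_smul]
  simp_rw [hexp, Finset.smul_sum]
  rw [integral_finsetSum _ fun r _ => (hmon r _).1]
  exact Finset.sum_eq_zero fun r _ => (hmon r _).2

theorem norm_taylor_sub_le {f : F → W} (hf : ContDiff ℝ ∞ f) (N : ℕ) {C : ℝ}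
    (hC : ∀ x, ‖iteratedFDeriv ℝ (N + 1) f x‖ ≤ C) (x y : F) :
    ‖f (x + y) - ∑ k ∈ Finset.range (N + 1),
      ((k.factorial : ℝ)⁻¹ • iteratedFDeriv ℝ k f x (fun _ => y))‖ ≤ C * ‖y‖ ^ (N + 1) := by
  have hC0 : 0 ≤ C := (norm_nonneg _).trans (hC x)
  rw [map_add_eq_sum_add_integral_iteratedFDeriv (n := N) (f := f) (x := x) (y := y)
    fun t _ => (hf.of_le (by exact_mod_cast le_top)).contDiffAt, add_sub_cancel_left, norm_smul]
  have h1 : ‖∫ t in (0 : ℝ)..1, (1 - t) ^ N • iteratedFDeriv ℝ (N + 1) f (x + t • y) (fun _ => y)‖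
      ≤ (C * ‖y‖ ^ (N + 1)) * |1 - 0| := by
    refine intervalIntegral.norm_integral_le_of_norm_le_const fun t ht => ?_
    rw [uIoc_of_le zero_le_one] at ht
    rw [norm_smul, norm_pow, Real.norm_eq_abs]
    have h2 : |1 - t| ^ N ≤ 1 :=
      pow_le_one₀ (abs_nonneg _) (abs_le.2 ⟨by linarith [ht.2], by linarith [ht.1]⟩)
    have h3 := (iteratedFDeriv ℝ (N + 1) f (x + t • y)).le_opNorm fun _ => y
    rw [Finset.prod_const, Finset.card_univ, Fintype.card_fin] at h3
    calc |1 - t| ^ N * ‖iteratedFDeriv ℝ (N + 1) f (x + t • y) fun _ => y‖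
        ≤ 1 * (C * ‖y‖ ^ (N + 1)) :=
          mul_le_mul h2 (h3.trans (mul_le_mul_of_nonneg_right (hC _) (by positivity)))
            (norm_nonneg _) zero_le_one
      _ = _ := one_mul _
  rw [sub_zero, abs_one, mul_one] at h1
  have h4 : ‖((N.factorial : ℝ))⁻¹‖ ≤ 1 := by
    rw [norm_inv, Real.norm_natCast]
    exact inv_le_one_of_one_le₀ (by exact_mod_cast N.factorial_pos)
  calc _ ≤ 1 * (C * ‖y‖ ^ (N + 1)) := mul_le_mul h4 h1 (norm_nonneg _) zero_le_one
    _ = _ := one_mul _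

/-- The difference between `f` and its mollification at scale `ε`. -/
noncomputable def mollifyError (ρ : 𝓢(F, ℂ)) (f : F → W) (ε : ℝ) (x : F) : W :=
  f x - ∫ w, ρ w • f (x + ε • w)

theorem BddDerivs.exists_norm_le {f : F → W} (hf : BddDerivs f) :
    ∃ C : ℝ, 0 ≤ C ∧ ∀ x, ‖f x‖ ≤ C := by
  obtain ⟨C, hC0, hC⟩ := hf.2 0
  exact ⟨C, hC0, fun x => by simpa using hC x⟩

theorem integrable_mollify (ρ : 𝓢(F, ℂ)) {f : F → W} (hf : BddDerivs f) (ε : ℝ) (x : F) :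
    Integrable fun w => ρ w • f (x + ε • w) := by
  obtain ⟨C, -, hC⟩ := hf.exists_norm_le
  have := hf.1.continuous
  exact integrable_schwartz_smul_pow ρ 0 (by fun_prop) (C := C) fun w => by simpa using hC _

/-- Integrating the Taylor polynomial of `f` at `x` against `ρ` returns `f x`: the constant term by
`∫ ρ = 1`, nothing from the others. Only the remainder is left, at most a constant times `‖ε w‖ ^ (N
+ 1)`, which is integrable against `|ρ|`. -/
theorem norm_mollifyError_le {ρ : 𝓢(F, ℂ)} (hρ : IsMollifier ρ) {f : F → W} (hf : BddDerivs f)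
    (N : ℕ) : ∃ C : ℝ, 0 ≤ C ∧ ∀ ε : ℝ, 0 ≤ ε → ∀ x, ‖mollifyError ρ f ε x‖ ≤ C * ε ^ (N + 1) := by
  obtain ⟨C, hC0, hC⟩ := hf.2 (N + 1)
  refine ⟨C * ∫ w, ‖w‖ ^ (N + 1) * ‖ρ w‖, by positivity, fun ε hε x => ?_⟩
  have hterm : ∀ (k : ℕ), Integrable (fun w => ρ w • ((k.factorial : ℝ)⁻¹ •
      iteratedFDeriv ℝ k f x (fun _ => ε • w))) ∧
      ∫ w, ρ w • ((k.factorial : ℝ)⁻¹ • iteratedFDeriv ℝ k f x (fun _ => ε • w))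
        = if k = 0 then f x else 0 := by
    intro k
    set A := iteratedFDeriv ℝ k f x with hA
    have hAe : ∀ w, ((k.factorial : ℝ)⁻¹ • A (fun _ => ε • w))
        = (((k.factorial : ℝ)⁻¹ * ε ^ k) • A) (fun _ => w) := fun w => by
      have := A.toMultilinearMap.map_smul_univ (fun _ => ε) (fun _ => w)
      rw [Finset.prod_const, Finset.card_univ, Fintype.card_fin] at this
      rw [show A (fun _ => ε • w) = ε ^ k • A (fun _ => w) from this, smul_smul]
      rfl
    simp_rw [hAe]
    set B := ((k.factorial : ℝ)⁻¹ * ε ^ k) • A with hB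
    refine ⟨integrable_schwartz_smul_pow ρ k (by fun_prop) (C := ‖B‖) fun w => ?_, ?_⟩
    · have := B.le_opNorm fun _ => w
      rwa [Finset.prod_const, Finset.card_univ, Fintype.card_fin] at this
    · rcases Nat.eq_zero_or_pos k with rfl | hk
      · have h1 : ∀ w : F, B (fun _ => w) = f x := fun w => by
          simp [hB, hA]
        simp_rw [h1]
        rw [integral_smul_const, hρ.integral_eq_one, one_smul]
        simp
      · rw [integral_multilinear_eq_zero hρ hk, if_neg hk.ne']
  have hsum : ∫ w, ∑ k ∈ Finset.range (N + 1), ρ w • ((k.factorial : ℝ)⁻¹ •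
      iteratedFDeriv ℝ k f x (fun _ => ε • w)) = f x := by
    rw [integral_finsetSum _ fun k _ => (hterm k).1]
    simp_rw [fun k => (hterm k).2]
    simp
  have hsi : Integrable fun w => ∑ k ∈ Finset.range (N + 1), ρ w • ((k.factorial : ℝ)⁻¹ •
      iteratedFDeriv ℝ k f x (fun _ => ε • w)) := integrable_finsetSum _ fun k _ => (hterm k).1
  have e : mollifyError ρ f ε x = -∫ w, ρ w • (f (x + ε • w) - ∑ k ∈ Finset.range (N + 1),
      ((k.factorial : ℝ)⁻¹ • iteratedFDeriv ℝ k f x (fun _ => ε • w))) := by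
    simp_rw [smul_sub, Finset.smul_sum]
    rw [integral_sub (integrable_mollify ρ hf ε x) hsi, hsum, neg_sub, mollifyError]
  rw [e, norm_neg, mul_right_comm, mul_comm _ (∫ w, _), ← integral_mul_const]
  refine norm_integral_le_of_norm_le ((ρ.integrable_pow_mul volume (N + 1)).mul_const _)
    (Filter.Eventually.of_forall fun w => ?_)
  rw [norm_smul]
  have h1 := norm_taylor_sub_le hf.1 N hC x (ε • w)
  rw [norm_smul, Real.norm_eq_abs, abs_of_nonneg hε, mul_pow] at h1
  calc _ ≤ ‖ρ w‖ * (C * (ε ^ (N + 1) * ‖w‖ ^ (N + 1))) := by gcongr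
    _ = _ := by ring

/-- Mollification commutes with differentiation, by dominated convergence. The derivative of the
error is therefore the error of the derivative, which is why `mollifyError` is defined for
vector-valued functions. -/
theorem hasFDerivAt_mollifyError (ρ : 𝓢(F, ℂ)) {f : F → W} (hf : BddDerivs f) (ε : ℝ) (x : F) :
    HasFDerivAt (mollifyError ρ f ε) (mollifyError ρ (fderiv ℝ f) ε x) x := by
  have hd : ∀ x, HasFDerivAt f (fderiv ℝ f x) x := fun x =>
    (hf.1.differentiable (by simp)).differentiableAt.hasFDerivAt
  obtain ⟨C, -, hC⟩ := hf.fderiv.exists_norm_le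
  refine (hd x).sub ?_
  refine hasFDerivAt_integral_of_dominated_of_fderiv_le (s := univ) (bound := fun w => ‖ρ w‖ * C)
    (F' := fun x w => ρ w • fderiv ℝ f (x + ε • w)) Filter.univ_mem
    (Filter.Eventually.of_forall fun y => (integrable_mollify ρ hf ε y).aestronglyMeasurable)
    (integrable_mollify ρ hf ε x) (integrable_mollify ρ hf.fderiv ε x).aestronglyMeasurable
    (Filter.Eventually.of_forall fun w y _ => ?_) (ρ.integrable.norm.mul_const C)
    (Filter.Eventually.of_forall fun w y _ => ?_)
  · rw [norm_smul]
    exact mul_le_mul_of_nonneg_left (hC _) (norm_nonneg _)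
  · exact ((hd (y + ε • w)).comp y ((hasFDerivAt_id y).add_const (ε • w))).const_smul (ρ w)

end Moments

/-! ### Derivatives of the mollification error, and its link with `Θ_ε` -/

section MollifyErrorDerivatives

variable {F : Type} [NormedAddCommGroup F] [NormedSpace ℝ F] [FiniteDimensional ℝ F]
  [MeasureSpace F] [BorelSpace F] [(volume : Measure F).IsAddHaarMeasure]

theorem contDiff_mollifyError (ρ : 𝓢(F, ℂ)) (ε : ℝ) (n : ℕ) :
    ∀ (W : Type) [NormedAddCommGroup W] [NormedSpace ℝ W] [NormedSpace ℂ W] [IsScalarTower ℝ ℂ W]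
      [CompleteSpace W] (f : F → W), BddDerivs f → ContDiff ℝ n (mollifyError ρ f ε) := by
  induction n with
  | zero =>
    intro W _ _ _ _ _ f hf
    exact contDiff_zero.2 (continuous_iff_continuousAt.2 fun x =>
      (hasFDerivAt_mollifyError ρ hf ε x).continuousAt)
  | succ n ih =>
    intro W _ _ _ _ _ f hf
    push_cast
    rw [contDiff_succ_iff_fderiv]
    refine ⟨fun x => (hasFDerivAt_mollifyError ρ hf ε x).differentiableAt, by simp, ?_⟩
    rw [funext fun x => (hasFDerivAt_mollifyError ρ hf ε x).fderiv]
    exact ih _ _ hf.fderiv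

/-- Induction on `i`, replacing `f` by `fderiv ℝ f`; this changes the target, hence the quantifier
over `W`. -/
theorem norm_iteratedFDeriv_mollifyError_le {ρ : 𝓢(F, ℂ)} (hρ : IsMollifier ρ) (N i : ℕ) :
    ∀ (W : Type) [NormedAddCommGroup W] [NormedSpace ℝ W] [NormedSpace ℂ W] [IsScalarTower ℝ ℂ W]
      [CompleteSpace W] (f : F → W), BddDerivs f →
      ∃ C : ℝ, 0 ≤ C ∧ ∀ ε : ℝ, 0 ≤ ε → ∀ x,
        ‖iteratedFDeriv ℝ i (mollifyError ρ f ε) x‖ ≤ C * ε ^ (N + 1) := by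
  induction i with
  | zero =>
    intro W _ _ _ _ _ f hf
    obtain ⟨C, hC0, hC⟩ := norm_mollifyError_le hρ hf N
    exact ⟨C, hC0, fun ε hε x => by rw [norm_iteratedFDeriv_zero]; exact hC ε hε x⟩
  | succ i ih =>
    intro W _ _ _ _ _ f hf
    obtain ⟨C, hC0, hC⟩ := ih _ _ hf.fderiv
    refine ⟨C, hC0, fun ε hε x => ?_⟩
    rw [← norm_iteratedFDeriv_fderiv,
      funext fun x => (hasFDerivAt_mollifyError ρ hf ε x).fderiv]
    exact hC ε hε x

theorem unifNegligible_mollifyError {ρ : 𝓢(F, ℂ)} (hρ : IsMollifier ρ) {f : F → ℂ}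
    (hf : BddDerivs f) : UnifNegligible fun (ε : Eps) => mollifyError ρ f ε := by
  refine ⟨fun ε => contDiff_infty.2 fun n => contDiff_mollifyError ρ ε n ℂ f hf, fun i N => ?_⟩
  obtain ⟨C, hC0, hC⟩ := norm_iteratedFDeriv_mollifyError_le hρ N i ℂ f hf
  refine ⟨C, hC0, fun ε x => (hC ε ε.pos.le x).trans (mul_le_mul_of_nonneg_left ?_ hC0)⟩
  rw [zpow_natCast]
  exact pow_le_pow_of_le_one ε.pos.le ε.le_one (Nat.le_succ N)

/-- Substitution `y = x + ε w`, whose Jacobian cancels `ε ^ (-d)`. The argument is `y - x` because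
the test variable of the kernel plays the role of `x` when the diagram is compared. -/
theorem integral_Theta_one_mul (ρ : 𝓢(F, ℂ)) (ε : Eps) {f : F → ℂ} (x : F) :
    ∫ y in tsupport f, Theta ρ (fun _ => 1) ε (y - x) * f y = ∫ w, ρ w * f (x + (ε : ℝ) • w) := by
  have hε := ε.pos
  rw [setIntegral_eq_integral_of_forall_compl_eq_zero fun y hy => by
    rw [image_eq_zero_of_notMem_tsupport hy, mul_zero]]
  have h1 := Measure.integral_comp_smul volume
    (fun z : F => ρ ((ε : ℝ)⁻¹ • z) * f (x + z)) (ε : ℝ)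
  simp_rw [smul_smul, inv_mul_cancel₀ hε.ne', one_smul] at h1
  rw [h1, ← integral_add_left_eq_self _ x, ← integral_smul]
  congr 1
  ext z
  rw [add_sub_cancel_left, Theta, abs_of_pos (by positivity), zpow_neg, zpow_natCast,
    Complex.real_smul]
  push_cast
  ring

end MollifyErrorDerivatives

/-! ### Comparison of the two sides of the diagram -/

section Comparison

theorem Represents.eq_cl {E : Type} [NormedAddCommGroup E] [NormedSpace ℝ E] {Ω : Opens E}
    {u : Net E} {g : GenFun Ω} (hu : Represents Ω u g) : g = cl Ω u := by
  obtain ⟨hu, rfl⟩ := hu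
  rw [cl, dif_pos hu]

theorem UnifNegligible.integral {G F : Type} [NormedAddCommGroup G] [NormedSpace ℝ G]
    [NormedAddCommGroup F] [NormedSpace ℝ F] [MeasurableSpace F] [BorelSpace F]
    (μ : Measure F) [IsFiniteMeasureOnCompacts μ] (L : Compacts F) {u : Net (G × F)}
    (hu : UnifNegligible u) : UnifNegligible fun ε z => ∫ y in L, u ε (z, y) ∂μ := by
  have hs : ∀ ε, ContDiffOn ℝ ∞ (u ε) (univ ×ˢ univ) := fun ε => (hu.1 ε).contDiffOn
  refine ⟨fun ε => contDiffOn_univ.1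
    (contDiffOn_integral μ L isOpen_univ isOpen_univ (subset_univ _) (hs ε)), fun i N => ?_⟩
  obtain ⟨C, hC0, hC⟩ := hu.2 i N
  refine ⟨μ.real L * C, by positivity, fun ε z => ?_⟩
  have := zpow_pos ε.pos (N : ℤ)
  rw [mul_assoc]
  exact norm_iteratedFDeriv_integral_le μ L isOpen_univ isOpen_univ (subset_univ _) (hs ε)
    (mem_univ z) i (by positivity) fun y _ => hC ε (z, y)

theorem Theta_sub {G : Type} [NormedAddCommGroup G] [NormedSpace ℝ G] (ρ : 𝓢(G, ℂ)) (χ χ' : G → ℝ)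
    (ε : Eps) (x : G) :
    Theta ρ (fun x => χ x - χ' x) ε x = Theta ρ χ ε x - Theta ρ χ' ε x := by
  simp only [Theta]
  push_cast
  ring

variable {E F : Type} [NormedAddCommGroup E] [NormedSpace ℝ E] [FiniteDimensional ℝ E]
  [NormedAddCommGroup F] [NormedSpace ℝ F] [FiniteDimensional ℝ F]

/-- The powers of `ε` split because dimensions add. The factorisation is stated with cut-off `1`, as
a general `χ` on the product is not a tensor product. -/
theorem Theta_one_prod {ρ₁ : 𝓢(E, ℂ)} {ρ₂ : 𝓢(F, ℂ)} {ρ : 𝓢(E × F, ℂ)}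
    (hρ : ∀ x y, ρ (x, y) = ρ₁ x * ρ₂ y) (ε : Eps) (x : E) (y : F) :
    Theta ρ (fun _ => 1) ε (x, y) = Theta ρ₁ (fun _ => 1) ε x * Theta ρ₂ (fun _ => 1) ε y := by
  simp only [Theta, Prod.smul_mk, hρ, Module.finrank_prod]
  have : (ε : ℝ) ^ (-((Module.finrank ℝ E + Module.finrank ℝ F : ℕ) : ℤ))
      = (ε : ℝ) ^ (-(Module.finrank ℝ E : ℤ)) * (ε : ℝ) ^ (-(Module.finrank ℝ F : ℤ)) := by
    rw [← zpow_add₀ ε.pos.ne']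
    congr 1
    push_cast
    ring
  rw [this]
  push_cast
  ring

variable [MeasureSpace F] [BorelSpace F] [(volume : Measure F).IsAddHaarMeasure]

/-- The kernel of the difference of the two sides of the diagram. -/
noncomputable def kernelDiff (ρ₁ : 𝓢(E, ℂ)) (ρ : 𝓢(E × F, ℂ)) (χ₁ : E → ℝ) (χ : E × F → ℝ)
    (f : F → ℂ) : Net (E × F) := fun ε p =>
  Theta ρ₁ χ₁ ε p.1 * f p.2 - ∫ y in tsupport f, Theta ρ χ ε (p.1, y - p.2) * f y

/-- Telescoping: the first and last terms pay for replacing `χ₁` and `χ` by `1`, and the middle one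
is the factored difference that remains. -/
theorem kernelDiff_eq {ρ₁ : 𝓢(E, ℂ)} {ρ₂ : 𝓢(F, ℂ)} {ρ : 𝓢(E × F, ℂ)}
    (hρ : ∀ x y, ρ (x, y) = ρ₁ x * ρ₂ y) (χ₁ : E → ℝ) {χ : E × F → ℝ} (hχ : ContDiff ℝ ∞ χ)
    {f : F → ℂ} (hf : Continuous f) (hfc : HasCompactSupport f) (ε : Eps) (p : E × F) :
    kernelDiff ρ₁ ρ χ₁ χ f ε p =
      Theta ρ₁ (fun x => χ₁ x - 1) ε p.1 * f p.2
        + Theta ρ₁ (fun _ => 1) ε p.1 * mollifyError ρ₂ f ε p.2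
        + ∫ y in tsupport f, Theta ρ (fun x => 1 - χ x) ε (p.1, y - p.2) * f y := by
  have hi : ∀ {χ' : E × F → ℝ}, ContDiff ℝ ∞ χ' →
      IntegrableOn (fun y => Theta ρ χ' ε (p.1, y - p.2) * f y) (tsupport f) := fun hχ' => by
    have := (contDiff_Theta ρ hχ' ε).continuous
    exact (Continuous.continuousOn (by fun_prop)).integrableOn_compact hfc.isCompact
  simp_rw [Theta_sub, sub_mul]
  rw [integral_sub (hi contDiff_const) (hi hχ)]
  simp_rw [Theta_one_prod hρ, mul_assoc]
  rw [integral_const_mul, integral_Theta_one_mul]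
  simp only [kernelDiff, mollifyError, smul_eq_mul]
  ring

theorem unifNegligible_kernelDiff {ρ₁ : 𝓢(E, ℂ)} {ρ₂ : 𝓢(F, ℂ)} {ρ : 𝓢(E × F, ℂ)}
    (hρ₂ : IsMollifier ρ₂) (hρ : ∀ x y, ρ (x, y) = ρ₁ x * ρ₂ y)
    {χ₁ : E → ℝ} (hχ₁ : BddDerivs fun x => (χ₁ x : ℂ)) (h₁ : ∀ᶠ x in nhds (0 : E), χ₁ x = 1)
    {χ : E × F → ℝ} (hχ : BddDerivs fun x => (χ x : ℂ)) (hχs : ContDiff ℝ ∞ χ)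
    (h : ∀ᶠ x in nhds (0 : E × F), χ x = 1)
    {f : F → ℂ} (hf : ContDiff ℝ ∞ f) (hfc : HasCompactSupport f) :
    UnifNegligible (kernelDiff ρ₁ ρ χ₁ χ f) := by
  have hfb := BddDerivs.of_hasCompactSupport hf hfc
  have t1 : UnifNegligible (Theta ρ₁ fun x => χ₁ x - 1) :=
    unifNegligible_Theta ρ₁ (by simpa using hχ₁.sub (bddDerivs_const 1))
      (h₁.mono fun x hx => by rw [hx, sub_self])
  have t3 : UnifNegligible (Theta ρ fun x => 1 - χ x) :=
    unifNegligible_Theta ρ (by simpa using (bddDerivs_const 1).sub hχ)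
      (h.mono fun x hx => by rw [hx, sub_self])
  have t2 : UnifModerate (Theta ρ₁ fun _ => 1) := unifModerate_Theta ρ₁ (bddDerivs_const _)
  have s1 := (hfb.unifModerate.comp_clm (ContinuousLinearMap.snd ℝ E F)).mul_negligible
    (t1.comp_clm (ContinuousLinearMap.fst ℝ E F))
  have s2 := (t2.comp_clm (ContinuousLinearMap.fst ℝ E F)).mul_negligible
    ((unifNegligible_mollifyError hρ₂ hfb).comp_clm (ContinuousLinearMap.snd ℝ E F))
  let A : (E × F) × F →L[ℝ] E × F :=
    ((ContinuousLinearMap.fst ℝ E F).comp (ContinuousLinearMap.fst ℝ (E × F) F)).prod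
      (ContinuousLinearMap.snd ℝ (E × F) F -
        (ContinuousLinearMap.snd ℝ E F).comp (ContinuousLinearMap.fst ℝ (E × F) F))
  have s3 := ((hfb.unifModerate.comp_clm (ContinuousLinearMap.snd ℝ (E × F) F)).mul_negligible
    (t3.comp_clm A)).integral volume ⟨tsupport f, hfc⟩
  have e : kernelDiff ρ₁ ρ χ₁ χ f = _ :=
    funext fun ε => funext fun p => kernelDiff_eq hρ χ₁ hχs hf.continuous hfc ε p
  rw [e]
  convert (s1.add s2).add s3 using 4
  · exact congrArg (· + _) (mul_comm _ _)
  · exact integral_congr_ae (Filter.Eventually.of_forall fun y => mul_comm _ _)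

theorem tsupport_tensor_subset {X : Opens E} {Y : Opens F} (φ : 𝓓(X, ℂ)) (f : 𝓓(Y, ℂ)) :
    tsupport (tensor φ f) ⊆ tsupport φ ×ˢ tsupport f :=
  closure_minimal (fun p (hp : φ p.1 * f p.2 ≠ 0) => ⟨subset_tsupport _ (left_ne_zero_of_mul hp),
    subset_tsupport _ (right_ne_zero_of_mul hp)⟩)
    ((isClosed_tsupport _).prod (isClosed_tsupport _))

/-- For small `ε` both nets are values of one form in jets, representing `h` on one compact set.
Their difference is that form applied to the uniformly negligible `kernelDiff`. -/
theorem isNegligible_regularize_sub_integralNet {X : Opens E} {Y : Opens F} {ρ₁ : 𝓢(E, ℂ)}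
    {ρ₂ : 𝓢(F, ℂ)} {ρ : 𝓢(E × F, ℂ)} (hρ₂ : IsMollifier ρ₂)
    (hρ : ∀ x y, ρ (x, y) = ρ₁ x * ρ₂ y) (c₁ : Cutoff X) (c : Cutoff (prodOpens X Y))
    (h : Distrib (prodOpens X Y)) (f : 𝓓(Y, ℂ)) {K : Set F} (hK : IsCompact K) (hKY : K ⊆ Y)
    (hfK : tsupport f ⊆ K) :
    IsNegligible X (regularize ρ₁ c₁ (kernelOp h f)
      - integralNet (regularize ρ c h) (fun _ => f) K) := by
  have : ProperSpace E := FiniteDimensional.proper_real E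
  have : ProperSpace F := FiniteDimensional.proper_real F
  have hm₁ := isModerate_regularize ρ₁ c₁ (kernelOp h f)
  have hm₂ : IsModerate X (integralNet (regularize ρ c h) (fun _ => f) K) :=
    isModerate_integralNet (isModerate_regularize ρ c h)
      (const_mem_moderate f.contDiff.contDiffOn) hK hKY
  refine ⟨((moderate X).sub_mem hm₁ hm₂).1, fun K₀ hK₀ hK₀X l N => ?_⟩
  obtain ⟨L, hL, hKL, hLX⟩ := exists_compact_between hK₀ X.isOpen hK₀X
  set S : Compacts F := ⟨tsupport f, f.hasCompactSupport⟩ with hS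
  obtain ⟨M₁, hM₁, η₁, hη₁, hker₁⟩ := exists_kernelTest_eq ρ₁ c₁ hL hLX
  obtain ⟨M₂, hM₂, η₂, hη₂, hker₂⟩ := exists_kernelTest_eq ρ c (hL.prod S.isCompact)
    (Set.prod_mono hLX f.tsupport_subset)
  -- One compact set must carry both the tensor products with `f` and the kernels on the product, so
  -- that the same `T` represents `h` on both.
  set M : Compacts (E × F) := M₁ ×ˢ S ⊔ M₂ with hM
  have hMc : (M : Set (E × F)) = (M₁ : Set E) ×ˢ (S : Set F) ∪ M₂ := rfl
  obtain ⟨k, T, hT⟩ := exists_jet_extension h M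
    (hMc ▸ union_subset (Set.prod_mono hM₁ f.tsupport_subset) hM₂)
  let A : E × (E × F) →L[ℝ] E × F :=
    (ContinuousLinearMap.fst ℝ E (E × F) -
      (ContinuousLinearMap.fst ℝ E F).comp (ContinuousLinearMap.snd ℝ E (E × F))).prod
      ((ContinuousLinearMap.snd ℝ E F).comp (ContinuousLinearMap.snd ℝ E (E × F)))
  have hneg := ((unifNegligible_kernelDiff hρ₂ hρ (bddDerivs_ofReal_testFunction c₁.χ) c₁.χ_eq_one
    (bddDerivs_ofReal_testFunction c.χ) c.χ.contDiff c.χ_eq_one f.contDiff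
    f.hasCompactSupport).comp_clm A).jetForm T
  refine UnifBigO.seminormBigO (fun i _ => hneg.2 i N) isOpen_interior hKL
    (lt_min hη₁ hη₂) fun ε hε x hx => ?_
  have hxL := interior_subset hx
  obtain ⟨a1, a2⟩ := hker₁ ε (hε.trans_le (min_le_left _ _)) x hxL
  have hs₁ : ContDiff ℝ ∞ fun p : E × F => Theta ρ₁ c₁.χ ε (x - p.1) * f p.2 :=
    ((contDiff_Theta ρ₁ c₁.χ.contDiff ε).comp (contDiff_const.sub contDiff_fst)).mul
      (f.contDiff.comp contDiff_snd)
  have hs₂ : ContDiff ℝ ∞ fun q : (E × F) × F => Theta ρ c.χ ε ((x, q.2) - q.1) * f q.2 :=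
    ((contDiff_Theta ρ c.χ.contDiff ε).comp
      ((contDiff_const.prodMk contDiff_snd).sub contDiff_fst)).mul (f.contDiff.comp contDiff_snd)
  have hs₃ : ContDiff ℝ ∞ fun p : E × F => ∫ y in S, Theta ρ c.χ ε ((x, y) - p) * f y :=
    contDiffOn_univ.1 (contDiffOn_integral volume S isOpen_univ isOpen_univ (subset_univ _)
      (Φ := fun q : (E × F) × F => Theta ρ c.χ ε ((x, q.2) - q.1) * f q.2) hs₂.contDiffOn)
  have e1 : regularize ρ₁ c₁ (kernelOp h f) ε x
      = T (jetOn M k fun p => Theta ρ₁ c₁.χ ε (x - p.1) * f p.2) := by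
    refine (hT (tensor (kernelTest ρ₁ c₁ ε x) f) ?_).trans ?_
    · refine (tsupport_tensor_subset _ f).trans ?_
      rw [hMc]
      exact (Set.prod_mono a2 subset_rfl).trans subset_union_left
    · congr 2
      funext p
      exact congrArg (· * f p.2) (congrFun a1 p.1)
  -- The integral is first cut down to the support of `f`, where `hker₂` removes `γ_ε`; then it is
  -- moved inside `T`.
  have e2 : integralNet (regularize ρ c h) (fun _ => f) K ε x
      = T (jetOn M k fun p => ∫ y in S, Theta ρ c.χ ε ((x, y) - p) * f y) := by
    rw [← integral_jetOn volume S T hs₂]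
    have h1 : ∫ y in K, regularize ρ c h ε (x, y) * f y
        = ∫ y in S, regularize ρ c h ε (x, y) * f y := by
      refine (setIntegral_eq_of_subset_of_forall_sdiff_eq_zero hK.isClosed.measurableSet hfK
        fun y hy => ?_)
      rw [image_eq_zero_of_notMem_tsupport hy.2, mul_zero]
    refine h1.trans (setIntegral_congr_fun S.isCompact.isClosed.measurableSet fun y hy => ?_)
    obtain ⟨b1, b2⟩ := hker₂ ε (hε.trans_le (min_le_right _ _)) (x, y) ⟨hxL, hy⟩
    have h2 : regularize ρ c h ε (x, y) = T (jetOn M k fun p => Theta ρ c.χ ε ((x, y) - p)) := by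
      rw [← b1]
      exact hT _ (b2.trans (hMc ▸ subset_union_right))
    have h3 := jetOn_smul M k (f := fun p => Theta ρ c.χ ε ((x, y) - p))
      ((contDiff_Theta ρ c.χ.contDiff ε).comp (contDiff_const.sub contDiff_id)) (f y)
    simp only [smul_eq_mul, mul_comm (f y)] at h3
    simp only [h2]
    rw [h3, map_smul, smul_eq_mul, mul_comm]
  simp only [Pi.sub_apply]
  rw [e1, e2, ← map_sub, ← jetOn_sub M k hs₁ hs₃]
  -- What remains inside `T` is `kernelDiff` at `A (x, p) = (x - p.1, p.2)`.
  rfl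

theorem supp_sigmaC_subset {Y : Opens F} (f : 𝓓(Y, ℂ)) : supp (sigmaC Y f).1 ⊆ tsupport f := by
  intro x hx
  by_contra hne
  let V : Opens F := ⟨(Y : Set F) \ tsupport f, Y.isOpen.sdiff (isClosed_tsupport f)⟩
  have hV : V ≤ Y := fun x hx => hx.1
  have hnull : restrict hV (sigmaC Y f).1 = 0 := by
    change restrict hV (sigma Y f f.contDiff.contDiffOn) = 0
    rw [sigma, restrict, Submodule.mapQ_apply, Submodule.Quotient.mk_eq_zero]
    refine ⟨fun _ => f.contDiff.contDiffOn, fun K _ hKV l N => ⟨0, 1, one_pos,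
      fun ε _ x hx i _ => ?_⟩⟩
    have : iteratedFDeriv ℝ i (f : F → ℂ) x = 0 := by
      by_contra hne
      exact (hKV hx).2 (support_iteratedFDeriv_subset i hne)
    simp [this]
  exact hx.2 (mem_iUnion.2 ⟨V, mem_iUnion.2 ⟨hV, mem_iUnion.2 ⟨hnull, ⟨hx.1, hne⟩⟩⟩⟩)

/-- By `genIntOpWellDefined` the right side may be computed with the regularised kernel, the
constant net `f` and any compact neighbourhood of the support of `f`, rather than with arbitrarily
chosen representatives. -/
theorem iS_kernelOp [LocallyCompactSpace F] {X : Opens E} {Y : Opens F} {ρ₁ : 𝓢(E, ℂ)}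
    {ρ₂ : 𝓢(F, ℂ)} {ρ : 𝓢(E × F, ℂ)} (hρ₂ : IsMollifier ρ₂)
    (hρ : ∀ x y, ρ (x, y) = ρ₁ x * ρ₂ y) (c₁ : Cutoff X) (c : Cutoff (prodOpens X Y))
    (h : Distrib (prodOpens X Y)) (f : 𝓓(Y, ℂ)) :
    iS ρ₁ c₁ (kernelOp h f) = genIntOp (iS ρ c h) (sigmaC Y f) := by
  have : ProperSpace E := FiniteDimensional.proper_real E
  have : ProperSpace F := FiniteDimensional.proper_real F
  obtain ⟨K, hK, hfK, hKY⟩ := exists_compact_between f.hasCompactSupport Y.isOpen f.tsupport_subset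
  have hr := isModerate_regularize ρ c h
  have hf : IsModerate Y fun _ => f := const_mem_moderate f.contDiff.contDiffOn
  have hrep := genIntOpWellDefined (iS ρ c h) (sigmaC Y f) (regularize ρ c h) (fun _ => f) K
    (represents_cl hr) ⟨hf, rfl⟩ hK ((supp_sigmaC_subset f).trans hfK) hKY
  rw [hrep.eq_cl]
  exact cl_eq (isModerate_regularize ρ₁ c₁ (kernelOp h f)) (isModerate_integralNet hr hf hK hKY)
    (isNegligible_regularize_sub_integralNet hρ₂ hρ c₁ c h f hK hKY (hfK.trans interior_subset))

end Comparison

end Colombeau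

theorem mainTheorem10 (m n : ℕ)
    (X : TopologicalSpace.Opens (EuclideanSpace ℝ (Fin m)))
    (Y : TopologicalSpace.Opens (EuclideanSpace ℝ (Fin n)))
    (ρ₁ : 𝓢(EuclideanSpace ℝ (Fin m), ℂ)) (ρ₂ : 𝓢(EuclideanSpace ℝ (Fin n), ℂ))
    (ρ : 𝓢(EuclideanSpace ℝ (Fin m) × EuclideanSpace ℝ (Fin n), ℂ))
    (hρ₁ : Colombeau.IsMollifier ρ₁) (hρ₂ : Colombeau.IsMollifier ρ₂)
    (hρ : ∀ x y, ρ (x, y) = ρ₁ x * ρ₂ y)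
    (c₁ : Colombeau.Cutoff X) (c : Colombeau.Cutoff (Colombeau.prodOpens X Y))
    (h : Colombeau.Distrib (Colombeau.prodOpens X Y)) :
    Colombeau.IsModerate (Colombeau.prodOpens X Y) (Colombeau.regularize ρ c h) ∧
    (∀ f : 𝓓(Y, ℂ), Colombeau.IsModerate X
      (Colombeau.regularize ρ₁ c₁ (Colombeau.kernelOp h f))) ∧
    (∀ f : Colombeau.GenFunC Y,
      Colombeau.GenIntOpWellDefined (Colombeau.iS ρ c h) f) ∧
    Colombeau.iS ρ₁ c₁ ∘ Colombeau.kernelOp h =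
      Colombeau.genIntOp (Colombeau.iS ρ c h) ∘ Colombeau.sigmaC Y :=
  ⟨Colombeau.isModerate_regularize ρ c h,
    fun f => Colombeau.isModerate_regularize ρ₁ c₁ (Colombeau.kernelOp h f),
    fun f => Colombeau.genIntOpWellDefined _ f,
    funext fun f => Colombeau.iS_kernelOp hρ₂ hρ c₁ c h f⟩
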